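/- **Setting.** Let $\gamma,\mu>0$, let $k:[0,\infty)\to\mathbb{R}$ be non-decreasing and bounded, and let $q$ be the CDF of a law on $[0,\infty)$ (the competition). Auctions occur at the times $T_1<T_2<\cdots$ of a Poisson process of intensity $\mu$; the highest competing bids $C_1,C_2,\dots$ are i.i.d. with CDF $q$ and independent of the arrivals. The age is the time elapsed since the last won auction; $\tau(T_i)$ denotes the age at which the $i$-th auction takes place. A bidder with bidding function $b$ (a measurable map $b:[0,\infty)\to[0,\infty)$) bids $b(\tau(T_i))$ at time $T_i$, wins if $b(\tau(T_i))>C_i$, then pays $C_i$, and his age is reset to $0$. Starting from age $\tau$, his expected discounted revenue is $$V_b(\tau)=\mathbb{E}\sum_{i\ge1}e^{-\gamma T_i}\bigl(k(\tau(T_i))-C_i\bigr)\mathbf 1\{b(\tau(T_i))>C_i\}\in[-\infty,\infty),$$ and $V^\star(\tau)=\sup_b V_b(\tau)$ over all bidding functions $b$. Let $p(x)=q(x)x-\int_0^x q(t)\,dt$ and $\pi(x)=q(x)x-p(x)=\int_0^x q(t)\,dt$ for $x\in\mathbb{R}$. For $v\in\mathbb{R}$ let $Z^v$ be the solution on $[0,\infty)$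 of $$\dot Y_t=\gamma Y_t-\mu\,\pi(k_t+v-Y_t),\qquad Y_0=v,$$ where a solution is a continuous function satisfying the integrated equation $Y_t=v+\int_0^t\bigl(\gamma Y_s-\mu\,\pi(k_s+v-Y_s)\bigr)ds$ for all $t\ge0$ (a classical solution if $k$ is continuous). **Algorithm.** Input: real numbers $a\le b$. At each iteration $n=0,1,2,\dots$ put $c=(a+b)/2$ and $y^{(n)}=Z^c$; if $y^{(n)}(t)\to+\infty$ as $t\to\infty$, set $b\leftarrow c$, otherwise set $a\leftarrow c$. **Theorem.** Suppose that $q$ is continuous on $\mathbb{R}$. Then $Z^v$ exists and is unique for every $v\in\mathbb{R}$, $V^\star(0)$ is finite, and, for every input with $a\le V^\star(0)\le b$, the iterates of the algorithm satisfy $$\bigl|V^\star(0)-y^{(n)}(0)\bigr|=O(1/2^n)\qquad(n\to\infty).$$ -/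

import Mathlib

open Set Filter Topology MeasureTheory ProbabilityTheory Asymptotics

open scoped ENNReal

namespace RepeatedAuction

noncomputable section

/-! ### One-shot second-price auction against a competition with CDF `q` -/

/-- The expected payment `p(b) = q(b) b - ∫₀ᵇ q(t) dt` when bidding `b`. -/
def expectedPayment (q : ℝ → ℝ) (b : ℝ) : ℝ := q b * b - ∫ t in (0 : ℝ)..b, q t

/-- The expected utility `U(v, b) = q(b) v - p(b)` when bidding `b` and valuing the item `v`. -/
def utility (q : ℝ → ℝ) (v b : ℝ) : ℝ := q b * v - expectedPayment q b

/-- The expected profit `π(v) = U(v, v)` of the truthful bid. -/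
def profit (q : ℝ → ℝ) (v : ℝ) : ℝ := utility q v v

/-! ### The repeated auction

An outcome `ω : ℕ → ℝ × ℝ` lists, for the auctions `0, 1, 2, …`, the waiting time `(ω i).1` between
the previous auction (or the time origin, for `i = 0`) and auction `i`, and the highest competing
bid `(ω i).2` at auction `i`. -/

/-- The law of the outcomes: auctions arrive along a Poisson process of intensity `μ`, that is, the
waiting times are i.i.d. exponential of rate `μ`; the competing bids are i.i.d. of law `P` and
independent of the arrivals. -/
def outcomeLaw (μ : ℝ) (P : Measure ℝ) : Measure (ℕ → ℝ × ℝ) :=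
  Measure.infinitePi fun _ : ℕ => (expMeasure μ).prod P

/-- The time `T_i` of auction `i`. -/
def auctionTime (ω : ℕ → ℝ × ℝ) (i : ℕ) : ℝ := ∑ j ∈ Finset.range (i + 1), (ω j).1

/-- The age (time since the last won auction) just after the first `i` auctions, for a bidder who
bids `b s` when the age is `s` and whose initial age is `τ`. The age is reset to `0` by a win, and a
win at an auction means that the bid is larger than the competition. -/
def ageAfter (b : ℝ → ℝ) (τ : ℝ) (ω : ℕ → ℝ × ℝ) : ℕ → ℝ
  | 0 => τ
  | i + 1 =>
    if (ω i).2 < b (ageAfter b τ ω i + (ω i).1) then 0 else ageAfter b τ ω i + (ω i).1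

/-- The age `τ(T_i)` at which auction `i` takes place. -/
def ageAt (b : ℝ → ℝ) (τ : ℝ) (ω : ℕ → ℝ × ℝ) (i : ℕ) : ℝ := ageAfter b τ ω i + (ω i).1

/-- The discounted gain `e^{-γ T_i} (k(τ(T_i)) - C_i) 1{b(τ(T_i)) > C_i}` from auction `i`. -/
def gain (γ : ℝ) (k b : ℝ → ℝ) (τ : ℝ) (ω : ℕ → ℝ × ℝ) (i : ℕ) : ℝ :=
  if (ω i).2 < b (ageAt b τ ω i) then
    Real.exp (-γ * auctionTime ω i) * (k (ageAt b τ ω i) - (ω i).2)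
  else 0

/-- The expected discounted revenue `V_b(τ) = 𝔼 ∑ᵢ e^{-γ T_i} (k(τ(T_i)) - C_i) 1{b(τ(T_i)) > C_i}`,
as an extended real number: the expected sum of the positive parts minus the expected sum of the
negative parts. (For bounded `k` the former is finite; the latter may be infinite for an unbounded
bidding function, and then `V_b(τ) = -∞`.) -/
def policyValue (γ μ : ℝ) (k : ℝ → ℝ) (P : Measure ℝ) (b : ℝ → ℝ) (τ : ℝ) : EReal :=
  ((∫⁻ ω, ∑' i, ENNReal.ofReal (gain γ k b τ ω i) ∂(outcomeLaw μ P) : ℝ≥0∞) : EReal) -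
    ((∫⁻ ω, ∑' i, ENNReal.ofReal (-gain γ k b τ ω i) ∂(outcomeLaw μ P) : ℝ≥0∞) : EReal)

/-- The bidding functions: measurable, with nonnegative bids. (Ages are nonnegative, so only the
values on `[0, ∞)` matter.) -/
def biddingFunctions : Set (ℝ → ℝ) := {b | Measurable b ∧ ∀ τ, 0 ≤ b τ}

/-- The optimal value `V⋆(τ) = sup_b V_b(τ)` over all bidding functions. -/
def optimalValue (γ μ : ℝ) (k : ℝ → ℝ) (P : Measure ℝ) (τ : ℝ) : EReal :=
  ⨆ b ∈ biddingFunctions, policyValue γ μ k P b τ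

/-! ### The differential equation and the bisection -/

/-- The right-hand side `Φ(t, y, l) = γ y - μ π(k_t + l - y)`. -/
def drift (γ μ : ℝ) (k q : ℝ → ℝ) (t y l : ℝ) : ℝ := γ * y - μ * profit q (k t + l - y)

/-- `Y` solves `Ẏ_t = Φ(t, Y_t, v)`, `Y_0 = v` on `[0, ∞)`. As `k` is only monotone and may jump,
a solution is a continuous function that satisfies the integrated equation; it is differentiable,
with the required derivative, wherever `k` is continuous. -/
def IsCauchySolution (γ μ : ℝ) (k q : ℝ → ℝ) (v : ℝ) (Y : ℝ → ℝ) : Prop :=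
  ContinuousOn Y (Ici 0) ∧
    ∀ t, 0 ≤ t → Y t = v + ∫ s in (0 : ℝ)..t, drift γ μ k q s (Y s) v

open Classical in
/-- The solution `Z^v` of the Cauchy problem with initial value and parameter `v` (and `0` if there
were none). -/
def solution (γ μ : ℝ) (k q : ℝ → ℝ) (v : ℝ) : ℝ → ℝ :=
  if h : ∃ Y, IsCauchySolution γ μ k q v Y then h.choose else 0

open Classical in
/-- The interval `(a, b)` at the start of iteration `n` of the algorithm run on the input `(a, b)`:
with `c = (a + b) / 2`, if `Z^c` diverges to `+∞` then `b ← c`, else `a ← c`. -/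
def bracket (γ μ : ℝ) (k q : ℝ → ℝ) (a b : ℝ) : ℕ → ℝ × ℝ
  | 0 => (a, b)
  | n + 1 =>
    let I := bracket γ μ k q a b n
    let c := (I.1 + I.2) / 2
    if Tendsto (solution γ μ k q c) atTop atTop then (I.1, c) else (c, I.2)

/-- The iterate `y⁽ⁿ⁾ = Z^c` of the algorithm, `c` being the midpoint of the current interval. -/
def iterate (γ μ : ℝ) (k q : ℝ → ℝ) (a b : ℝ) (n : ℕ) : ℝ → ℝ :=
  solution γ μ k q
    (((bracket γ μ k q a b n).1 + (bracket γ μ k q a b n).2) / 2)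

end

end RepeatedAuction

/-! The optimal value is the fixed point of a Bellman operator. Let `W u` be the continuation value
at age `u` and let an auction take place at that age. Losing leaves `W u`; winning against the bid
`C` gives `k u - C + W 0`. The best choice has mean `W u + π(k u + W 0 - W u)`, because `π(x) = 𝔼 (x
- C)⁺`. Averaging over the discounted exponential waiting time defines an operator on bounded
continuous functions that contracts the sup norm by `μ / (γ + μ) < 1`; `exists_isBellmanSolution`
gives its fixed point `W`.

Two facts about `W` carry the theorem. By verification (`policyValue_le`, `policyValue_optimalBid`,
`optimalValue_eq`), discounted gains plus continuation value form a supermartingale for every policy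
and a martingale for the bid `(k + W 0 - W)⁺`, so the optimal value equals `W`. By differentiating
the fixed-point equation (`IsBellmanSolution.isCauchySolution`), `W` solves the Cauchy problem with
parameter `W 0`: the optimal value at age zero is the parameter of a bounded solution.

The Cauchy problem repels: `IsCauchySolution.gap_le` shows that solutions with parameters `v ≤ v'`
are at least `(v' - v) e^{γt}` apart. Hence parameters above `W 0` give divergence to `+∞`, those
below do not, and the test of the algorithm keeps `W 0` in a bracket that halves at each iteration.
-/

namespace RepeatedAuction

/-! ### The profit function -/

section Profit

theorem profit_eq (q : ℝ → ℝ) (x : ℝ) : profit q x = ∫ t in (0 : ℝ)..x, q t := by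
  unfold profit utility expectedPayment; ring

variable (P : Measure ℝ)

theorem intervalIntegrable_cdf (x y : ℝ) : IntervalIntegrable (cdf P) volume x y :=
  (monotone_cdf P).intervalIntegrable

theorem profit_sub (x y : ℝ) :
    profit (cdf P) y - profit (cdf P) x = ∫ t in x..y, cdf P t := by
  rw [profit_eq, profit_eq,
    intervalIntegral.integral_interval_sub_left (intervalIntegrable_cdf P _ _)
      (intervalIntegrable_cdf P _ _)]

theorem profit_mono : Monotone (profit (cdf P)) := fun x y h => by
  rw [← sub_nonneg, profit_sub]
  exact intervalIntegral.integral_nonneg h fun t _ => cdf_nonneg P t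

theorem profit_sub_le {x y : ℝ} (h : x ≤ y) : profit (cdf P) y - profit (cdf P) x ≤ y - x := by
  rw [profit_sub]
  calc ∫ t in x..y, cdf P t ≤ ∫ _ in x..y, (1 : ℝ) :=
        intervalIntegral.integral_mono_on h (intervalIntegrable_cdf P _ _) (by simp)
          fun t _ => cdf_le_one P t
    _ = y - x := by simp

theorem abs_profit_sub_le (x y : ℝ) :
    |profit (cdf P) x - profit (cdf P) y| ≤ |x - y| := by
  rcases le_total x y with h | h
  · rw [abs_sub_comm, abs_sub_comm x, abs_of_nonneg (sub_nonneg.2 (profit_mono P h)),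
      abs_of_nonneg (sub_nonneg.2 h)]
    exact profit_sub_le P h
  · rw [abs_of_nonneg (sub_nonneg.2 (profit_mono P h)), abs_of_nonneg (sub_nonneg.2 h)]
    exact profit_sub_le P h

theorem continuous_profit : Continuous (profit (cdf P)) :=
  (LipschitzWith.of_dist_le_mul (K := 1) fun x y => by
    simpa [Real.dist_eq] using abs_profit_sub_le P x y).continuous

theorem profit_zero : profit (cdf P) 0 = 0 := by simp [profit_eq]

variable [IsProbabilityMeasure P]

theorem ae_nonneg_of_measure_Iio_eq_zero {P : Measure ℝ} (hP : P (Iio 0) = 0) :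
    ∀ᵐ c ∂P, 0 ≤ c := by
  rw [ae_iff]; convert hP using 2; ext c; simp

theorem cdf_of_neg {P : Measure ℝ} [IsProbabilityMeasure P] (hP : P (Iio 0) = 0) {t : ℝ}
    (ht : t < 0) : cdf P t = 0 := by
  rw [cdf_eq_real, measureReal_eq_zero_iff]
  exact measure_mono_null (fun s hs => lt_of_le_of_lt hs ht) hP

/-- `π(x) = 𝔼 (x - C)⁺`. -/
theorem profit_cdf_eq_integral (hP : P (Iio 0) = 0) (x : ℝ) :
    profit (cdf P) x = ∫ c, max (x - c) 0 ∂P := by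
  have h0 := ae_nonneg_of_measure_Iio_eq_zero hP
  rw [profit_eq]
  rcases lt_or_ge x 0 with hx | hx
  · have h1 : ∫ t in (0 : ℝ)..x, cdf P t = ∫ t in (0 : ℝ)..x, (0 : ℝ) := by
      rw [intervalIntegral.integral_symm, intervalIntegral.integral_symm x,
        intervalIntegral.integral_of_le hx.le, intervalIntegral.integral_of_le hx.le,
        integral_Ioc_eq_integral_Ioo, integral_Ioc_eq_integral_Ioo]
      congr 1
      exact setIntegral_congr_fun measurableSet_Ioo fun t ht => cdf_of_neg hP ht.2
    rw [h1, intervalIntegral.integral_zero]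
    symm
    apply integral_eq_zero_of_ae
    filter_upwards [h0] with c hc
    exact max_eq_right (by simp; linarith)
  -- Fubini: `q(t)` is the mean of `1{C ≤ t}`, and integrating this indicator over `t ∈ [0, x]`
  -- gives `(x - C)⁺` because `C ≥ 0`.
  · have h1 : ∀ t, cdf P t = ∫ c, (Iic t).indicator (fun _ => (1 : ℝ)) c ∂P := fun t => by
      rw [integral_indicator measurableSet_Iic]; simp [cdf_eq_real]
    have h2 : ∀ᵐ c ∂P, ∫ t in (0 : ℝ)..x, (Iic t).indicator (fun _ => (1 : ℝ)) c
        = max (x - c) 0 := by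
      filter_upwards [h0] with c hc
      have : ∀ t, (Iic t).indicator (fun _ => (1 : ℝ)) c = (Ici c).indicator (fun _ => (1 : ℝ)) t :=
        fun t => by simp [indicator_apply]
      simp_rw [this]
      rw [intervalIntegral.integral_of_le hx, integral_indicator measurableSet_Ici,
        Measure.restrict_restrict measurableSet_Ici]
      have h3 : ((Ici c ∩ Ioc 0 x : Set ℝ) =ᵐ[volume] (Icc c x : Set ℝ)) := by
        rcases hc.eq_or_lt with rfl | hc'
        · have : (Ici (0:ℝ) ∩ Ioc 0 x) = Ioc 0 x := inter_eq_right.2 fun t ht => ht.1.le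
          rw [this]
          exact Ioc_ae_eq_Icc
        · have : (Ici c ∩ Ioc 0 x) = Icc c x := by
            ext t; simp only [mem_inter_iff, mem_Ici, mem_Ioc, mem_Icc]
            exact ⟨fun h => ⟨h.1, h.2.2⟩, fun h => ⟨h.1, by linarith [h.1], h.2⟩⟩
          rw [this]
          exact ae_eq_refl _
      rw [Measure.restrict_congr_set h3]
      simp [Measure.real, ENNReal.toReal_ofReal']
    rw [← integral_congr_ae h2, ← intervalIntegral_integral_swap]
    · simp_rw [← h1]
    · rw [uIoc_of_le hx]
      apply Integrable.of_bound (C := 1)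
      · refine (Measurable.indicator (f := fun _ : ℝ × ℝ => (1 : ℝ)) measurable_const
          (measurableSet_le measurable_snd measurable_fst)).aestronglyMeasurable.congr ?_
        exact Eventually.of_forall fun p => rfl
      · refine Eventually.of_forall fun p => ?_
        simp only [Function.uncurry, indicator_apply]
        split_ifs <;> simp

end Profit

/-! ### Integral inequalities and integral equations -/

section IntegralEquation

/-- If `E' ≥ L E` (in integrated form) wherever `E < 0`, then `E` cannot become negative. -/
theorem nonneg_of_integral_inequality {E f : ℝ → ℝ} {L : ℝ} (hL : 0 ≤ L)
    (hE : ContinuousOn E (Ici 0)) (h0 : 0 ≤ E 0)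
    (hint : ∀ t, 0 ≤ t → IntervalIntegrable f volume 0 t)
    (heq : ∀ t, 0 ≤ t → E t = E 0 + ∫ s in (0 : ℝ)..t, f s)
    (hf : ∀ s, 0 ≤ s → E s < 0 → L * E s ≤ f s) (t : ℝ) (ht : 0 ≤ t) : 0 ≤ E t := by
  by_contra! hneg
  -- the last time `t₀` before `t` at which `E` is nonnegative
  have hcl : IsCompact (Icc 0 t ∩ E ⁻¹' Ici 0) :=
    isCompact_Icc.of_isClosed_subset
      ((hE.mono Icc_subset_Ici_self).preimage_isClosed_of_isClosed isClosed_Icc isClosed_Ici)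
      inter_subset_left
  obtain ⟨t₀, ⟨⟨h00, h0t⟩, hE0⟩, hmax⟩ :=
    hcl.exists_isGreatest ⟨0, ⟨le_rfl, ht⟩, h0⟩
  have hE0 : 0 ≤ E t₀ := hE0
  have hlt : t₀ < t := lt_of_le_of_ne h0t (by rintro rfl; linarith)
  have hneg' : ∀ s ∈ Ioc t₀ t, E s < 0 := fun s hs => by
    by_contra! h
    exact absurd (hmax ⟨⟨h00.trans hs.1.le, hs.2⟩, h⟩) (not_le.2 hs.1)
  -- a short interval `[t₀, t₁]`
  set t₁ := min t (t₀ + 1 / (2 * (L + 1))) with ht₁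
  have hpos : 0 < 1 / (2 * (L + 1)) := by positivity
  have h01 : t₀ < t₁ := lt_min hlt (by linarith)
  have h1t : t₁ ≤ t := min_le_left _ _
  have hlen : L * (t₁ - t₀) ≤ 1 / 2 := by
    have h1 : t₁ - t₀ ≤ 1 / (2 * (L + 1)) := by linarith [min_le_right t (t₀ + 1 / (2 * (L + 1)))]
    calc L * (t₁ - t₀) ≤ (L + 1) * (1 / (2 * (L + 1))) := by
          apply mul_le_mul (by linarith) h1 (by linarith) (by linarith)
      _ = 1 / 2 := by field_simp
  -- At a minimum point `s` the inequality `f ≥ L * E ≥ L * E s` on `(t₀, s)` gives `E s ≥ L * (s -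
  -- t₀) * E s ≥ E s / 2`, which is impossible for `E s < 0`.
  obtain ⟨s, hs, hmin⟩ := isCompact_Icc.exists_isMinOn (nonempty_Icc.2 h01.le)
    (hE.mono (fun r hr => h00.trans hr.1) : ContinuousOn E (Icc t₀ t₁))
  have hsneg : E s < 0 := (hmin (right_mem_Icc.2 h01.le)).trans_lt (hneg' _ ⟨h01, h1t⟩)
  have hts : t₀ ≤ s := hs.1
  have hi : IntervalIntegrable f volume t₀ s :=
    (hint t₀ h00).symm.trans (hint s (h00.trans hts))
  have hEs : E s = E t₀ + ∫ r in t₀..s, f r := by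
    rw [heq s (h00.trans hts), heq t₀ h00, add_assoc,
      intervalIntegral.integral_add_adjacent_intervals (hint t₀ h00) hi]
  have hge : (s - t₀) * (L * E s) ≤ ∫ r in t₀..s, f r := by
    have h1 : ∫ _ in t₀..s, L * E s = (s - t₀) * (L * E s) := by
      rw [intervalIntegral.integral_const, smul_eq_mul]
    rw [← h1]
    apply intervalIntegral.integral_mono_on_of_le_Ioo hts (by simp) hi
    intro r hr
    have hr' : r ∈ Ioc t₀ t := ⟨hr.1, hr.2.le.trans (hs.2.trans h1t)⟩
    refine le_trans ?_ (hf r (h00.trans hr.1.le) (hneg' r hr'))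
    exact mul_le_mul_of_nonneg_left (hmin ⟨hr.1.le, hr.2.le.trans hs.2⟩) hL
  have h3 : L * (s - t₀) ≤ 1 / 2 :=
    le_trans (mul_le_mul_of_nonneg_left (by linarith [hs.2]) hL) hlen
  nlinarith

/-- Global solvability of `Y t = v + ∫₀ᵗ f(s, Y s) ds` for `f` Lipschitz in the second variable. -/
theorem exists_integral_solution {f : ℝ → ℝ → ℝ} {L B : ℝ} (hL : 0 < L)
    (hLip : ∀ s y y', |f s y - f s y'| ≤ L * |y - y'|) (hB : ∀ s, |f s 0| ≤ B)
    (hmeas : Measurable fun p : ℝ × ℝ => f p.1 p.2) (v : ℝ) :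
    ∃ Y : ℝ → ℝ, Continuous Y ∧ ∀ t, 0 ≤ t → Y t = v + ∫ s in (0 : ℝ)..t, f s (Y s) := by
  have hB0 : 0 ≤ B := (abs_nonneg _).trans (hB 0)
  have hbd : ∀ s y, |f s y| ≤ L * |y| + B := fun s y => by
    have := abs_add_le (f s y - f s 0) (f s 0)
    have h2 := hLip s y 0
    simp only [sub_add_cancel, sub_zero] at this h2
    linarith [hB s]
  have hint : ∀ u : ℝ → ℝ, Continuous u → ∀ a b,
      IntervalIntegrable (fun s => f s (u s)) volume a b := fun u hu a b => by
    have hg : Continuous fun s => L * |u s| + B := by fun_prop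
    refine IntervalIntegrable.mono_fun (hg.intervalIntegrable a b) ?_ ?_
    · exact (hmeas.comp (measurable_id.prodMk hu.measurable)).aestronglyMeasurable
    · exact Eventually.of_forall fun s => (hbd s (u s)).trans (le_abs_self _)
  have hexp : ∀ (C t : ℝ), 0 ≤ t → ∫ s in (0 : ℝ)..t, L * (Real.exp (2 * L * s) * C)
      = (Real.exp (2 * L * t) - 1) * C / 2 := fun C t ht => by
    have h1 : ∀ s, HasDerivAt (fun s => Real.exp (2 * L * s) * C / 2)
        (L * (Real.exp (2 * L * s) * C)) s := fun s => by
      have := ((((hasDerivAt_id s).const_mul (2 * L)).exp).mul_const C).div_const 2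
      convert! this using 1
      simp; ring
    rw [intervalIntegral.integral_eq_sub_of_hasDerivAt (fun s _ => h1 s)
      (Continuous.intervalIntegrable (by fun_prop) _ _)]
    simp; ring
  -- the Picard operator in the weighted variable `u t = exp (-2 L t) Y t`
  let G : (ℝ → ℝ) → ℝ → ℝ := fun u t => Real.exp (-(2 * L * max t 0)) *
    (v + ∫ s in (0 : ℝ)..max t 0, f s (Real.exp (2 * L * s) * u s))
  -- The weight `exp (-2 L t)` makes the operator a contraction of factor `1/2` on the whole
  -- half-line, so no gluing of local solutions is needed. The truncation `max t 0` makes `G u`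
  -- constant on the negative axis, so that it is defined and bounded on all of `ℝ`.
  have hsub : ∀ (u w : ℝ → ℝ) (C : ℝ), Continuous u → Continuous w → (∀ s, |u s - w s| ≤ C) →
      ∀ t, |G u t - G w t| ≤ C / 2 := fun u w C hu hw hC t => by
    set r := max t 0 with hr
    have hr0 : 0 ≤ r := le_max_right _ _
    have hC0 : 0 ≤ C := (abs_nonneg _).trans (hC 0)
    have h1 : G u t - G w t = Real.exp (-(2 * L * r)) * ∫ s in (0 : ℝ)..r,
        (f s (Real.exp (2 * L * s) * u s) - f s (Real.exp (2 * L * s) * w s)) := by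
      rw [intervalIntegral.integral_sub (hint _ (by fun_prop) _ _) (hint _ (by fun_prop) _ _)]
      simp only [G, ← hr]; ring
    have h2 : |∫ s in (0 : ℝ)..r,
        (f s (Real.exp (2 * L * s) * u s) - f s (Real.exp (2 * L * s) * w s))|
        ≤ ∫ s in (0 : ℝ)..r, L * (Real.exp (2 * L * s) * C) := by
      rw [← Real.norm_eq_abs]
      apply intervalIntegral.norm_integral_le_of_norm_le hr0
      · refine Eventually.of_forall fun s _ => (hLip _ _ _).trans ?_
        rw [← mul_sub, abs_mul, Real.abs_exp]
        have := hC s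
        gcongr
      · exact Continuous.intervalIntegrable (by fun_prop) _ _
    rw [hexp C r hr0] at h2
    rw [h1, abs_mul, Real.abs_exp]
    calc _ ≤ Real.exp (-(2 * L * r)) * ((Real.exp (2 * L * r) - 1) * C / 2) := by gcongr
      _ = (1 - Real.exp (-(2 * L * r))) * C / 2 := by
          rw [Real.exp_neg]; field_simp
      _ ≤ C / 2 := by
          have := Real.exp_pos (-(2 * L * r))
          nlinarith
  have hcont : ∀ u : ℝ → ℝ, Continuous u → Continuous (G u) := fun u hu => by
    have h1 : Continuous fun t : ℝ => ∫ s in (0 : ℝ)..t, f s (Real.exp (2 * L * s) * u s) :=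
      intervalIntegral.continuous_primitive (fun a b => hint _ (by fun_prop) a b) 0
    have h2 : Continuous fun t : ℝ => max t 0 := by fun_prop
    have := h1.comp h2
    simp only [Function.comp_def] at this
    simp only [G]
    fun_prop
  have hbound0 : ∀ t, |G 0 t| ≤ |v| + B / L := fun t => by
    set r := max t 0 with hr
    have hr0 : 0 ≤ r := le_max_right _ _
    have h1 : |∫ s in (0 : ℝ)..r, f s (Real.exp (2 * L * s) * 0)| ≤ B * r := by
      have := intervalIntegral.norm_integral_le_of_norm_le_const
        (f := fun s => f s (Real.exp (2 * L * s) * 0)) (a := 0) (b := r) (C := B)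
        (fun s _ => by simpa using hB s)
      simpa [abs_of_nonneg hr0] using this
    have h2 : 2 * L * r + 1 ≤ Real.exp (2 * L * r) := Real.add_one_le_exp _
    have h3 : |v + ∫ s in (0 : ℝ)..r, f s (Real.exp (2 * L * s) * 0)| ≤ |v| + B * r :=
      (abs_add_le _ _).trans (by linarith)
    have h4 : |v| + B * r ≤ Real.exp (2 * L * r) * (|v| + B / L) := by
      have e : B * r = (L * r) * (B / L) := by field_simp
      have hBL : 0 ≤ B / L := by positivity
      have hLr : 0 ≤ L * r := by positivity
      nlinarith [abs_nonneg v]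
    simp only [G, Pi.zero_apply, ← hr]
    rw [abs_mul, Real.abs_exp, Real.exp_neg, inv_mul_le_iff₀ (Real.exp_pos _)]
    exact h3.trans h4
  have hbound : ∀ u : BoundedContinuousFunction ℝ ℝ, ∀ t,
      ‖G u t‖ ≤ |v| + B / L + ‖u‖ / 2 := fun u t => by
    have h1 := hsub u 0 ‖u‖ u.continuous continuous_const
      (fun s => by simpa using u.norm_coe_le_norm s) t
    have h2 := abs_add_le (G u t - G 0 t) (G 0 t)
    rw [sub_add_cancel] at h2
    rw [Real.norm_eq_abs]
    linarith [hbound0 t]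
  let T : BoundedContinuousFunction ℝ ℝ → BoundedContinuousFunction ℝ ℝ := fun u =>
    BoundedContinuousFunction.ofNormedAddCommGroup (G u) (hcont u u.continuous) _ (hbound u)
  have hT : ContractingWith (1 / 2) T := by
    refine ⟨by rw [← NNReal.coe_lt_coe]; norm_num, LipschitzWith.of_dist_le_mul fun u w => ?_⟩
    rw [BoundedContinuousFunction.dist_le (by positivity)]
    intro t
    have := hsub u w (dist u w) u.continuous w.continuous
      (fun s => by simpa [Real.dist_eq] using u.dist_coe_le_dist (g := w) s) t
    simpa [T, Real.dist_eq, div_eq_inv_mul] using this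
  set u := ContractingWith.fixedPoint T hT with hu
  have hfix : T u = u := hT.fixedPoint_isFixedPt
  have hfix' : ∀ t, G u t = u t := fun t => by
    conv_rhs => rw [← hfix]
    rfl
  refine ⟨fun t => Real.exp (2 * L * t) * u t, by fun_prop, fun t ht => ?_⟩
  change Real.exp (2 * L * t) * u t = v + ∫ s in (0 : ℝ)..t, f s (Real.exp (2 * L * s) * u s)
  rw [← hfix' t]
  simp only [G, max_eq_left ht]
  rw [← mul_assoc, ← Real.exp_add]
  simp

end IntegralEquation

/-! ### The Cauchy problem -/

section Cauchy

variable {γ μ : ℝ} {k : ℝ → ℝ} {K : ℝ} (P : Measure ℝ)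

theorem abs_drift_sub_le (hγ : 0 < γ) (hμ : 0 < μ) (v s y y' : ℝ) :
    |drift γ μ k (cdf P) s y v - drift γ μ k (cdf P) s y' v| ≤ (γ + μ) * |y - y'| := by
  have h := abs_profit_sub_le P (k s + v - y') (k s + v - y)
  rw [show k s + v - y' - (k s + v - y) = y - y' by ring] at h
  have e : drift γ μ k (cdf P) s y v - drift γ μ k (cdf P) s y' v
      = γ * (y - y') + μ * (profit (cdf P) (k s + v - y') - profit (cdf P) (k s + v - y)) := by
    unfold drift; ring
  rw [e]
  refine (abs_add_le _ _).trans ?_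
  rw [abs_mul, abs_mul, abs_of_pos hγ, abs_of_pos hμ, add_mul]
  gcongr

theorem abs_drift_zero_le (hμ : 0 < μ) (hK : ∀ t, |k t| ≤ K) (v s : ℝ) :
    |drift γ μ k (cdf P) s 0 v| ≤ μ * (K + |v|) := by
  have h := abs_profit_sub_le P (k s + v) 0
  rw [profit_zero, sub_zero, sub_zero] at h
  unfold drift
  rw [mul_zero, zero_sub, abs_neg, abs_mul, abs_of_pos hμ, sub_zero]
  have := abs_add_le (k s) v
  gcongr
  linarith [hK s]

theorem measurable_drift (hk : Monotone k) (v : ℝ) :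
    Measurable fun p : ℝ × ℝ => drift γ μ k (cdf P) p.1 p.2 v := by
  unfold drift
  have h1 := (continuous_profit P).measurable
  have h2 := hk.measurable
  fun_prop

theorem exists_isCauchySolution (hγ : 0 < γ) (hμ : 0 < μ) (hk : Monotone k)
    (hK : ∀ t, |k t| ≤ K) (v : ℝ) : ∃ Y, IsCauchySolution γ μ k (cdf P) v Y := by
  obtain ⟨Y, hY, h⟩ := exists_integral_solution (f := fun s y => drift γ μ k (cdf P) s y v)
    (add_pos hγ hμ) (abs_drift_sub_le P hγ hμ v) (abs_drift_zero_le P hμ hK v)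
    (measurable_drift P hk v) v
  exact ⟨Y, hY.continuousOn, h⟩

theorem isCauchySolution_solution (hγ : 0 < γ) (hμ : 0 < μ) (hk : Monotone k)
    (hK : ∀ t, |k t| ≤ K) (v : ℝ) :
    IsCauchySolution γ μ k (cdf P) v (solution γ μ k (cdf P) v) := by
  have h := exists_isCauchySolution P hγ hμ hk hK v
  unfold solution
  rw [dif_pos h]
  exact h.choose_spec

theorem IsCauchySolution.apply_zero {q : ℝ → ℝ} {v : ℝ} {Y : ℝ → ℝ}
    (h : IsCauchySolution γ μ k q v Y) : Y 0 = v := by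
  simpa using h.2 0 le_rfl

variable {P}

theorem IsCauchySolution.intervalIntegrable (hγ : 0 < γ) (hμ : 0 < μ) (hk : Monotone k)
    (hK : ∀ t, |k t| ≤ K) {v : ℝ} {Y : ℝ → ℝ} (h : IsCauchySolution γ μ k (cdf P) v Y)
    {t : ℝ} (ht : 0 ≤ t) :
    IntervalIntegrable (fun s => drift γ μ k (cdf P) s (Y s) v) volume 0 t := by
  -- `Y` is controlled only on `[0, ∞)`; freezing it at its initial value for negative times gives a
  -- globally continuous function with the same integral.
  have hY : Continuous fun s => Y (max s 0) :=
    h.1.comp_continuous (by fun_prop) fun s => mem_Ici.2 (le_max_right _ _)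
  have hg : Continuous fun s => (γ + μ) * |Y (max s 0)| + μ * (K + |v|) :=
    (continuous_const.mul hY.abs).add continuous_const
  have h1 : IntervalIntegrable (fun s => drift γ μ k (cdf P) s (Y (max s 0)) v) volume 0 t := by
    refine IntervalIntegrable.mono_fun (hg.intervalIntegrable 0 t)
      ((measurable_drift P hk v).comp
        (measurable_id.prodMk hY.measurable)).aestronglyMeasurable ?_
    refine Eventually.of_forall fun s => ?_
    have h2 := abs_drift_sub_le (k := k) P hγ hμ v s (Y (max s 0)) 0
    have h3 := abs_drift_zero_le (γ := γ) P hμ hK v s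
    have h4 := abs_add_le (drift γ μ k (cdf P) s (Y (max s 0)) v - drift γ μ k (cdf P) s 0 v)
      (drift γ μ k (cdf P) s 0 v)
    rw [sub_add_cancel] at h4
    rw [sub_zero] at h2
    exact (h4.trans (add_le_add h2 h3)).trans (le_abs_self _)
  refine h1.congr fun s hs => ?_
  rw [uIoc_of_le ht] at hs
  simp only [max_eq_left hs.1.le]

/-- Two solutions with parameters `v ≤ v'` drift apart exponentially. -/
theorem IsCauchySolution.gap_le (hγ : 0 < γ) (hμ : 0 < μ) (hk : Monotone k)
    (hK : ∀ t, |k t| ≤ K) {v v' : ℝ} (hv : v ≤ v') {Y Y' : ℝ → ℝ}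
    (h : IsCauchySolution γ μ k (cdf P) v Y) (h' : IsCauchySolution γ μ k (cdf P) v' Y')
    {t : ℝ} (ht : 0 ≤ t) : (v' - v) * Real.exp (γ * t) ≤ Y' t - Y t := by
  have hexp : ∀ t, ∫ s in (0 : ℝ)..t, (v' - v) * (γ * Real.exp (γ * s))
      = (v' - v) * Real.exp (γ * t) - (v' - v) := fun t => by
    have h1 : ∀ s, HasDerivAt (fun s => (v' - v) * Real.exp (γ * s))
        ((v' - v) * (γ * Real.exp (γ * s))) s := fun s => by
      have := (((hasDerivAt_id s).const_mul γ).exp).const_mul (v' - v)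
      convert! this using 1
      simp only [id_eq, mul_one]; ring
    rw [intervalIntegral.integral_eq_sub_of_hasDerivAt (fun s _ => h1 s)
      (Continuous.intervalIntegrable (by fun_prop) _ _)]
    simp
  have hi := fun {t : ℝ} (ht : 0 ≤ t) => h.intervalIntegrable hγ hμ hk hK ht
  have hi' := fun {t : ℝ} (ht : 0 ≤ t) => h'.intervalIntegrable hγ hμ hk hK ht
  have hie : ∀ t, IntervalIntegrable (fun s => (v' - v) * (γ * Real.exp (γ * s))) volume 0 t :=
    fun t => Continuous.intervalIntegrable (by fun_prop) _ _
  -- Let `E` be the gap minus `(v' - v) e^{γt}`; it starts at `0`. Since `e^{γs} ≥ 1`, the argument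
  -- of `π` for `Y'` exceeds that for `Y` by at most `-E`. Where `E < 0`, monotonicity and the
  -- Lipschitz constant `1` of `π` bound the increase of `π` by `-E`, whence `E' ≥ (γ + μ) E`.
  have key := nonneg_of_integral_inequality
    (E := fun t => Y' t - Y t - (v' - v) * Real.exp (γ * t))
    (f := fun s => drift γ μ k (cdf P) s (Y' s) v' - drift γ μ k (cdf P) s (Y s) v
      - (v' - v) * (γ * Real.exp (γ * s))) (L := γ + μ) (add_pos hγ hμ).le
    ((h'.1.sub h.1).sub (by fun_prop))
    (by simp [h.apply_zero, h'.apply_zero])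
    (fun t ht => ((hi' ht).sub (hi ht)).sub (hie t))
    (fun t ht => by
      rw [intervalIntegral.integral_sub ((hi' ht).sub (hi ht)) (hie t),
        intervalIntegral.integral_sub (hi' ht) (hi ht), hexp, h.2 t ht, h'.2 t ht,
        h.apply_zero, h'.apply_zero]
      simp only [mul_zero, Real.exp_zero, mul_one]
      ring)
    (fun s hs hneg => by
      have he : 1 ≤ Real.exp (γ * s) := Real.one_le_exp (by positivity)
      have h1 : profit (cdf P) (k s + v' - Y' s) ≤ profit (cdf P) (k s + v - Y s)
          - (Y' s - Y s - (v' - v) * Real.exp (γ * s)) := by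
        have h2 : k s + v' - Y' s ≤
            k s + v - Y s - (Y' s - Y s - (v' - v) * Real.exp (γ * s)) := by
          nlinarith
        have h3 := profit_mono P h2
        have h4 := profit_sub_le P (x := k s + v - Y s)
          (y := k s + v - Y s - (Y' s - Y s - (v' - v) * Real.exp (γ * s))) (by linarith)
        linarith
      unfold drift
      nlinarith)
    t ht
  linarith

theorem IsCauchySolution.eqOn (hγ : 0 < γ) (hμ : 0 < μ) (hk : Monotone k)
    (hK : ∀ t, |k t| ≤ K) {v : ℝ} {Y Y' : ℝ → ℝ}
    (h : IsCauchySolution γ μ k (cdf P) v Y) (h' : IsCauchySolution γ μ k (cdf P) v Y') :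
    EqOn Y Y' (Ici 0) := fun t ht => by
  have h1 := h.gap_le hγ hμ hk hK le_rfl h' ht
  have h2 := h'.gap_le hγ hμ hk hK le_rfl h ht
  rw [sub_self, zero_mul] at h1 h2
  linarith

/-- Above the parameter of a bounded solution, solutions tend to `+∞`. -/
theorem IsCauchySolution.tendsto_atTop (hγ : 0 < γ) (hμ : 0 < μ) (hk : Monotone k)
    (hK : ∀ t, |k t| ≤ K) {v v' B : ℝ} (hv : v < v') {Y Y' : ℝ → ℝ}
    (h : IsCauchySolution γ μ k (cdf P) v Y) (h' : IsCauchySolution γ μ k (cdf P) v' Y')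
    (hB : ∀ t, |Y t| ≤ B) : Tendsto Y' atTop atTop := by
  have h1 : Tendsto (fun t => (v' - v) * Real.exp (γ * t) + -B) atTop atTop :=
    tendsto_atTop_add_const_right _ _ ((Real.tendsto_exp_atTop.comp
      (tendsto_id.const_mul_atTop hγ)).const_mul_atTop (sub_pos.2 hv))
  refine tendsto_atTop_mono' _ ?_ h1
  filter_upwards [eventually_ge_atTop 0] with t ht
  linarith [h.gap_le hγ hμ hk hK hv.le h' ht, (abs_le.1 (hB t)).1]

/-- Below the parameter of a bounded solution, solutions do not tend to `+∞`. -/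
theorem IsCauchySolution.not_tendsto_atTop (hγ : 0 < γ) (hμ : 0 < μ) (hk : Monotone k)
    (hK : ∀ t, |k t| ≤ K) {v v' B : ℝ} (hv : v' < v) {Y Y' : ℝ → ℝ}
    (h : IsCauchySolution γ μ k (cdf P) v Y) (h' : IsCauchySolution γ μ k (cdf P) v' Y')
    (hB : ∀ t, |Y t| ≤ B) : ¬ Tendsto Y' atTop atTop := fun hT => by
  obtain ⟨t, ht0, ht⟩ := ((eventually_ge_atTop 0).and (hT.eventually_gt_atTop B)).exists
  have h1 := h'.gap_le hγ hμ hk hK hv.le h ht0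
  have h2 : 0 < (v - v') * Real.exp (γ * t) := mul_pos (sub_pos.2 hv) (Real.exp_pos _)
  linarith [(abs_le.1 (hB t)).2]

end Cauchy

/-! ### The bounded solution of the Bellman equation -/

section Bellman

/-- `W_u + π(k_u + W_0 - W_u)`: the value of an auction at age `u` when the continuation value is
`W`. -/
noncomputable def auctionValue (k : ℝ → ℝ) (P : Measure ℝ) (W : ℝ → ℝ) (u : ℝ) : ℝ :=
  W u + profit (cdf P) (k u + W 0 - W u)

/-- `W` is the expected discounted value of the next auction. -/
def IsBellmanSolution (γ μ : ℝ) (k : ℝ → ℝ) (P : Measure ℝ) (W : ℝ → ℝ) : Prop :=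
  ∀ a, W a = Real.exp ((γ + μ) * a) *
    ∫ u in Ioi a, μ * Real.exp (-(γ + μ) * u) * auctionValue k P W u

variable {γ μ : ℝ} {k : ℝ → ℝ} {K : ℝ} {P : Measure ℝ}

/-- These are Blackwell's conditions. The map `x + π(k + y - x)` is non-decreasing in `x` because
`π` is 1-Lipschitz, non-decreasing in `y` because `π` is monotone, and shifting `x` and `y` together
by `d` shifts its value by `d`. -/
theorem auctionValue_le_add {W W' : ℝ → ℝ} {d : ℝ} (h : ∀ t, W t ≤ W' t + d) (u : ℝ) :
    auctionValue k P W u ≤ auctionValue k P W' u + d := by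
  unfold auctionValue
  have hu := h u
  have h0 := h 0
  have h1 : profit (cdf P) (k u + W 0 - W u) ≤ profit (cdf P) (k u + (W' 0 + d) - W u) :=
    profit_mono P (by linarith)
  have h2 := profit_sub_le P (x := k u + W' 0 - W' u) (y := k u + (W' 0 + d) - W u) (by linarith)
  linarith

theorem abs_auctionValue_sub_le {W W' : ℝ → ℝ} {d : ℝ} (h : ∀ t, |W t - W' t| ≤ d) (u : ℝ) :
    |auctionValue k P W u - auctionValue k P W' u| ≤ d := by
  have h1 := auctionValue_le_add (k := k) (P := P) (W := W) (W' := W') (d := d)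
    (fun t => by linarith [(abs_le.1 (h t)).2]) u
  have h2 := auctionValue_le_add (k := k) (P := P) (W := W') (W' := W) (d := d)
    (fun t => by linarith [(abs_le.1 (h t)).1]) u
  exact abs_le.2 ⟨by linarith, by linarith⟩

theorem abs_auctionValue_le (hK : ∀ t, |k t| ≤ K) {W : ℝ → ℝ} {d : ℝ} (h : ∀ t, |W t| ≤ d)
    (u : ℝ) : |auctionValue k P W u| ≤ d + K := by
  have h1 := abs_auctionValue_sub_le (k := k) (P := P) (W := W) (W' := 0) (d := d)
    (by simpa using h) u
  have h2 : |auctionValue k P 0 u| ≤ K := by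
    have := abs_profit_sub_le P (k u) 0
    simp only [profit_zero, sub_zero] at this
    simpa [auctionValue] using this.trans (hK u)
  have h3 := abs_add_le (auctionValue k P W u - auctionValue k P 0 u) (auctionValue k P 0 u)
  rw [sub_add_cancel] at h3
  linarith

theorem measurable_auctionValue (hk : Monotone k) {W : ℝ → ℝ} (hW : Measurable W) :
    Measurable (auctionValue k P W) := by
  have h1 := (continuous_profit P).measurable
  have h2 := hk.measurable
  unfold auctionValue
  fun_prop

theorem integrableOn_discounted {l : ℝ} (hl : 0 < l) {g : ℝ → ℝ} (hg : Measurable g) {B : ℝ}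
    (hB : ∀ u, |g u| ≤ B) (a : ℝ) :
    IntegrableOn (fun u => μ * Real.exp (-l * u) * g u) (Ioi a) := by
  refine Integrable.mul_bdd (c := B) ((integrableOn_exp_mul_Ioi (neg_lt_zero.2 hl) a).const_mul μ)
    hg.aestronglyMeasurable (Eventually.of_forall hB)

/-- The kernel `μ e^{-l(u - a)}` on `(a, ∞)` has mass `μ / l`. With `l = γ + μ` this yields both the
boundedness and the contraction factor of the Bellman operator. -/
theorem abs_integral_discounted_le {l : ℝ} (hl : 0 < l) (hμ : 0 < μ) {g : ℝ → ℝ} {B : ℝ}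
    (hB : ∀ u, |g u| ≤ B) (a : ℝ) :
    |Real.exp (l * a) * ∫ u in Ioi a, μ * Real.exp (-l * u) * g u| ≤ μ / l * B := by
  have h1 : |∫ u in Ioi a, μ * Real.exp (-l * u) * g u|
      ≤ ∫ u in Ioi a, μ * B * Real.exp (-l * u) := by
    rw [← Real.norm_eq_abs]
    refine norm_integral_le_of_norm_le
      ((integrableOn_exp_mul_Ioi (neg_lt_zero.2 hl) a).const_mul _) ?_
    refine Eventually.of_forall fun u => ?_
    rw [Real.norm_eq_abs, abs_mul, abs_mul, Real.abs_exp, abs_of_pos hμ, mul_right_comm]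
    gcongr
    exact hB u
  rw [integral_const_mul, integral_exp_mul_Ioi (neg_lt_zero.2 hl)] at h1
  rw [abs_mul, Real.abs_exp]
  calc _ ≤ Real.exp (l * a) * (μ * B * (-Real.exp (-l * a) / -l)) := by gcongr
    _ = μ / l * B := by
      rw [neg_mul, Real.exp_neg]; field_simp

theorem continuous_integral_discounted {l : ℝ} (hl : 0 < l) {g : ℝ → ℝ} (hg : Measurable g)
    {B : ℝ} (hB : ∀ u, |g u| ≤ B) :
    Continuous fun a => Real.exp (l * a) * ∫ u in Ioi a, μ * Real.exp (-l * u) * g u := by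
  have hi := fun a => integrableOn_discounted (μ := μ) hl hg hB a
  have h1 : ∀ a, ∫ u in Ioi a, μ * Real.exp (-l * u) * g u
      = (∫ u in Ioi (0 : ℝ), μ * Real.exp (-l * u) * g u)
        - ∫ u in (0 : ℝ)..a, μ * Real.exp (-l * u) * g u := fun a => by
    rw [← intervalIntegral.integral_Ioi_sub_Ioi' (hi 0) (hi a), sub_sub_cancel]
  have h2 : Continuous fun a => ∫ u in (0 : ℝ)..a, μ * Real.exp (-l * u) * g u :=
    intervalIntegral.continuous_primitive (fun a b => by
      rw [intervalIntegrable_iff]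
      exact (hi (min a b)).mono_set fun x hx => hx.1) 0
  have h3 : (fun a => Real.exp (l * a) * ∫ u in Ioi a, μ * Real.exp (-l * u) * g u)
      = fun a => Real.exp (l * a) * ((∫ u in Ioi (0 : ℝ), μ * Real.exp (-l * u) * g u)
        - ∫ u in (0 : ℝ)..a, μ * Real.exp (-l * u) * g u) :=
    funext fun a => congrArg _ (h1 a)
  rw [h3]
  fun_prop

theorem exists_isBellmanSolution (hγ : 0 < γ) (hμ : 0 < μ) (hk : Monotone k)
    (hK : ∀ t, |k t| ≤ K) (P : Measure ℝ) :
    ∃ (W : ℝ → ℝ) (B : ℝ), Continuous W ∧ (∀ t, |W t| ≤ B) ∧ IsBellmanSolution γ μ k P W := by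
  have hl : 0 < γ + μ := add_pos hγ hμ
  have hb : ∀ (W : BoundedContinuousFunction ℝ ℝ) t, |W t| ≤ ‖W‖ := fun W t =>
    W.norm_coe_le_norm t
  let T : BoundedContinuousFunction ℝ ℝ → BoundedContinuousFunction ℝ ℝ := fun W =>
    BoundedContinuousFunction.ofNormedAddCommGroup
      (fun a => Real.exp ((γ + μ) * a) *
        ∫ u in Ioi a, μ * Real.exp (-(γ + μ) * u) * auctionValue k P W u)
      (continuous_integral_discounted hl (measurable_auctionValue hk W.continuous.measurable)
        (abs_auctionValue_le hK (hb W))) _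
      (abs_integral_discounted_le hl hμ (abs_auctionValue_le hK (hb W)))
  have hT : ContractingWith (Real.toNNReal (μ / (γ + μ))) T := by
    refine ⟨?_, LipschitzWith.of_dist_le_mul fun W W' => ?_⟩
    · rw [Real.toNNReal_lt_one, div_lt_one hl]; linarith
    rw [Real.coe_toNNReal _ (by positivity), BoundedContinuousFunction.dist_le (by positivity)]
    intro t
    have h1 := abs_integral_discounted_le (μ := μ) hl hμ
      (abs_auctionValue_sub_le (k := k) (P := P) (W := W) (W' := W') (d := dist W W')
        (fun s => by simpa [Real.dist_eq] using W.dist_coe_le_dist (g := W') s)) t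
    have h2 : ∀ W : BoundedContinuousFunction ℝ ℝ, IntegrableOn
        (fun u => μ * Real.exp (-(γ + μ) * u) * auctionValue k P W u) (Ioi t) := fun W =>
      integrableOn_discounted hl (measurable_auctionValue hk W.continuous.measurable)
        (abs_auctionValue_le hK (hb W)) t
    simp_rw [mul_sub] at h1
    rw [integral_sub (h2 W) (h2 W'), mul_sub] at h1
    exact h1
  obtain ⟨W, hW⟩ : ∃ W, T W = W := ⟨_, hT.fixedPoint_isFixedPt⟩
  refine ⟨W, _, W.continuous, hb W, fun a => ?_⟩
  conv_lhs => rw [← hW]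
  rfl

/-- Where `k` is continuous, differentiating the fixed-point equation gives `W' = (γ + μ) W - μ
auctionValue`, and the terms `μ W` cancel to leave `drift`. A monotone `k` has only countably many
discontinuities, which the fundamental theorem of calculus tolerates for continuous `W`. -/
theorem IsBellmanSolution.isCauchySolution (hγ : 0 < γ) (hμ : 0 < μ) (hk : Monotone k)
    (hK : ∀ t, |k t| ≤ K) {W : ℝ → ℝ} {B : ℝ} (hW : Continuous W) (hB : ∀ t, |W t| ≤ B)
    (h : IsBellmanSolution γ μ k P W) : IsCauchySolution γ μ k (cdf P) (W 0) W := by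
  refine ⟨hW.continuousOn, fun t ht => ?_⟩
  have hl : 0 < γ + μ := add_pos hγ hμ
  have hm := measurable_auctionValue (P := P) hk hW.measurable
  set F : ℝ → ℝ := fun u => μ * Real.exp (-(γ + μ) * u) * auctionValue k P W u with hF
  have hi : ∀ a, IntegrableOn F (Ioi a) := fun a =>
    integrableOn_discounted hl hm (abs_auctionValue_le hK hB) a
  have hii : ∀ a b, IntervalIntegrable F volume a b := fun a b => by
    rw [intervalIntegrable_iff]
    exact (hi (min a b)).mono_set fun x hx => hx.1
  have hWeq : W = fun a => Real.exp ((γ + μ) * a) *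
      ((∫ u in Ioi (0 : ℝ), F u) - ∫ u in (0 : ℝ)..a, F u) := by
    funext a
    rw [← intervalIntegral.integral_Ioi_sub_Ioi' (hi 0) (hi a), h a, sub_sub_cancel]
  have hFm : Measurable F := by fun_prop
  have hderiv : ∀ s, ContinuousAt k s →
      HasDerivAt W (drift γ μ k (cdf P) s (W s) (W 0)) s := fun s hs => by
    have hFc : ContinuousAt F s := by
      have h1 : ContinuousAt (auctionValue k P W) s := by
        unfold auctionValue
        have h3 := hW.continuousAt (x := s)
        exact h3.add ((continuous_profit P).continuousAt.comp (by fun_prop))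
      exact ContinuousAt.mul (by fun_prop) h1
    have h1 : HasDerivAt (fun a => ∫ u in (0 : ℝ)..a, F u) (F s) s :=
      intervalIntegral.integral_hasDerivAt_right (hii 0 s)
        (hFm.stronglyMeasurable.stronglyMeasurableAtFilter) hFc
    have h2 : HasDerivAt (fun a => Real.exp ((γ + μ) * a))
        (Real.exp ((γ + μ) * s) * (γ + μ)) s := by
      simpa using ((hasDerivAt_id s).const_mul (γ + μ)).exp
    have h3 := h2.mul (h1.const_sub (∫ u in Ioi (0 : ℝ), F u))
    have h4 : W s = Real.exp ((γ + μ) * s) *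
      ((∫ u in Ioi (0 : ℝ), F u) - ∫ u in (0 : ℝ)..s, F u) := congrFun hWeq s
    have h5 : Real.exp ((γ + μ) * s) * F s = μ * auctionValue k P W s := by
      simp only [hF]
      rw [neg_mul, Real.exp_neg]
      field_simp
    convert! h3 using 1
    rw [mul_right_comm, ← h4, mul_neg, h5]
    unfold drift auctionValue
    ring
  have hdm : IntervalIntegrable (fun s => drift γ μ k (cdf P) s (W s) (W 0)) volume 0 t := by
    have e : (fun s => drift γ μ k (cdf P) s (W s) (W 0))
        = fun s => (γ + μ) * W s - μ * auctionValue k P W s := by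
      funext s; unfold drift auctionValue; ring
    rw [e]
    refine (Continuous.intervalIntegrable (by fun_prop) _ _).sub
      (IntervalIntegrable.const_mul ?_ μ)
    exact (intervalIntegrable_const (c := B + K)).mono_fun hm.aestronglyMeasurable
      (Eventually.of_forall fun s => (abs_auctionValue_le hK hB s).trans (le_abs_self _))
  rw [integral_eq_of_hasDerivAt_off_countable W _ hk.countable_not_continuousAt hW.continuousOn
    (fun s hs => hderiv s (by simpa using hs.2)) hdm]
  ring

end Bellman

/-! ### One auction -/

section OneAuction

variable {γ μ : ℝ} {k : ℝ → ℝ} {K : ℝ} {P : Measure ℝ} {W : ℝ → ℝ} {B : ℝ}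

theorem integral_expMeasure (hμ : 0 < μ) (f : ℝ → ℝ) :
    ∫ t, f t ∂expMeasure μ = ∫ t in Ioi 0, μ * Real.exp (-(μ * t)) * f t := by
  have hm : Measurable (gammaPDF 1 μ) := (measurable_gammaPDFReal 1 μ).ennreal_ofReal
  rw [expMeasure, gammaMeasure, integral_withDensity_eq_integral_toReal_smul hm
    (Eventually.of_forall fun x => ENNReal.ofReal_lt_top), ← integral_Ici_eq_integral_Ioi,
    ← integral_indicator measurableSet_Ici]
  congr 1
  funext t
  have h := exponentialPDF_eq μ t
  rw [exponentialPDF, exponentialPDFReal] at h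
  rw [gammaPDF, h, smul_eq_mul]
  by_cases ht : 0 ≤ t
  · rw [if_pos ht, indicator_of_mem (mem_Ici.2 ht), ENNReal.toReal_ofReal (by positivity)]
  · rw [if_neg ht, indicator_of_notMem (by simpa using ht)]; simp

theorem ae_nonneg_expMeasure (μ : ℝ) : ∀ᵐ t ∂expMeasure μ, 0 ≤ t := by
  apply ae_nonneg_of_measure_Iio_eq_zero
  rw [expMeasure, gammaMeasure, withDensity_apply _ measurableSet_Iio]
  exact lintegral_gammaPDF_of_nonpos le_rfl

theorem setIntegral_Ioi_comp_add (f : ℝ → ℝ) (a : ℝ) :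
    ∫ t in Ioi 0, f (a + t) = ∫ u in Ioi a, f u := by
  rw [← integral_indicator measurableSet_Ioi, ← integral_indicator measurableSet_Ioi,
    ← integral_add_left_eq_self ((Ioi a).indicator f) a]
  congr 1
  funext t
  simp [indicator_apply]

theorem integral_exp_neg_expMeasure (hγ : 0 < γ) (hμ : 0 < μ) :
    ∫ t, Real.exp (-γ * t) ∂expMeasure μ = μ / (γ + μ) := by
  have hl : 0 < γ + μ := add_pos hγ hμ
  rw [integral_expMeasure hμ]
  have : ∀ t, μ * Real.exp (-(μ * t)) * Real.exp (-γ * t) = μ * Real.exp (-(γ + μ) * t) :=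
    fun t => by rw [mul_assoc, ← Real.exp_add]; ring_nf
  simp_rw [this]
  rw [integral_const_mul, integral_exp_mul_Ioi (neg_lt_zero.2 hl)]
  rw [mul_zero, Real.exp_zero, neg_div_neg_eq, mul_one_div]

/-- The discounted value of an auction with waiting time `p.1` and competition `p.2` at initial age
`a`, when bidding optimally for the continuation value `W`. -/
noncomputable def stepValue (γ : ℝ) (k W : ℝ → ℝ) (a : ℝ) (p : ℝ × ℝ) : ℝ :=
  Real.exp (-γ * p.1) * max (W (a + p.1)) (k (a + p.1) + W 0 - p.2)

theorem measurable_stepValue (hk : Monotone k) (hW : Continuous W) :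
    Measurable fun x : ℝ × (ℝ × ℝ) => stepValue γ k W x.1 x.2 := by
  have h1 := hk.measurable
  have h2 := hW.measurable
  unfold stepValue
  fun_prop

theorem abs_stepValue_le (hγ : 0 < γ) (hK : ∀ t, |k t| ≤ K) (hB : ∀ t, |W t| ≤ B) (a : ℝ)
    {p : ℝ × ℝ} (h1 : 0 ≤ p.1) (h2 : 0 ≤ p.2) : |stepValue γ k W a p| ≤ K + B := by
  have hK0 := (abs_nonneg _).trans (hK 0)
  have hW := abs_le.1 (hB (a + p.1))
  have hW0 := abs_le.1 (hB 0)
  have hk := abs_le.1 (hK (a + p.1))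
  have hm : |max (W (a + p.1)) (k (a + p.1) + W 0 - p.2)| ≤ K + B := by
    rw [abs_le]
    exact ⟨le_max_of_le_left (by linarith), max_le (by linarith) (by linarith)⟩
  have he : Real.exp (-γ * p.1) ≤ 1 := Real.exp_le_one_iff.2 (by nlinarith)
  rw [stepValue, abs_mul, Real.abs_exp]
  calc _ ≤ 1 * (K + B) := by gcongr
    _ = K + B := one_mul _

/-- Integrating out the bid uses `𝔼 max(x, y - C) = x + π(y - x)`; the discount `e^{-γt}` then
merges with the density `μ e^{-μt}`, and translation by `a` produces the Bellman integral. -/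
theorem integral_stepValue [IsProbabilityMeasure P] (hP : P (Iio 0) = 0) (hγ : 0 < γ) (hμ : 0 < μ)
    (hk : Monotone k) (hK : ∀ t, |k t| ≤ K) (hW : Continuous W) (hB : ∀ t, |W t| ≤ B)
    (h : IsBellmanSolution γ μ k P W) (a : ℝ) :
    ∫ p, stepValue γ k W a p ∂((expMeasure μ).prod P) = W a := by
  have := isProbabilityMeasure_expMeasure hμ
  have h0 := ae_nonneg_of_measure_Iio_eq_zero hP
  have hmeas : Measurable (stepValue γ k W a) :=
    (measurable_stepValue hk hW).comp (measurable_const.prodMk measurable_id)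
  have hint : Integrable (stepValue γ k W a) ((expMeasure μ).prod P) := by
    refine Integrable.of_bound hmeas.aestronglyMeasurable (K + B) ?_
    filter_upwards [Measure.quasiMeasurePreserving_fst.ae (ae_nonneg_expMeasure μ),
      Measure.quasiMeasurePreserving_snd.ae h0] with p h1 h2
    exact abs_stepValue_le hγ hK hB a h1 h2
  rw [integral_prod _ hint, integral_expMeasure hμ, h a]
  have hin : ∀ t, ∫ c, stepValue γ k W a (t, c) ∂P
      = Real.exp (-γ * t) * auctionValue k P W (a + t) := fun t => by
    simp only [stepValue]
    rw [integral_const_mul, auctionValue, profit_cdf_eq_integral P hP]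
    have hI : Integrable (fun c => max (k (a + t) + W 0 - W (a + t) - c) 0) P := by
      refine Integrable.of_bound (by fun_prop) |k (a + t) + W 0 - W (a + t)| ?_
      filter_upwards [h0] with c hc
      rw [Real.norm_eq_abs, abs_of_nonneg (le_max_right _ _)]
      exact max_le (by linarith [le_abs_self (k (a + t) + W 0 - W (a + t))]) (abs_nonneg _)
    have e : ∀ c, max (W (a + t)) (k (a + t) + W 0 - c)
        = W (a + t) + max (k (a + t) + W 0 - W (a + t) - c) 0 := fun c => by
      rw [← max_add_add_left, max_comm]
      congr 1 <;> ring
    simp_rw [e]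
    rw [integral_add (integrable_const _) hI]
    simp
  simp_rw [hin]
  rw [← setIntegral_Ioi_comp_add
    (fun u => μ * Real.exp (-(γ + μ) * u) * auctionValue k P W u) a, ← integral_const_mul]
  congr 1
  funext t
  have e : Real.exp (-(μ * t)) * Real.exp (-γ * t)
      = Real.exp ((γ + μ) * a) * Real.exp (-(γ + μ) * (a + t)) := by
    rw [← Real.exp_add, ← Real.exp_add]; ring_nf
  linear_combination μ * auctionValue k P W (a + t) * e

end OneAuction

/-! ### The process of ages -/

section AgeProcess

/-- The time elapsed after the first `n` waiting times. -/
def elapsed (ω : ℕ → ℝ × ℝ) (n : ℕ) : ℝ := ∑ j ∈ Finset.range n, (ω j).1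

theorem auctionTime_eq_elapsed (ω : ℕ → ℝ × ℝ) (i : ℕ) : auctionTime ω i = elapsed ω (i + 1) := rfl

theorem elapsed_succ (ω : ℕ → ℝ × ℝ) (n : ℕ) : elapsed ω (n + 1) = elapsed ω n + (ω n).1 :=
  Finset.sum_range_succ _ _

variable {b : ℝ → ℝ} {τ : ℝ}

theorem ageAfter_congr {ω ω' : ℕ → ℝ × ℝ} : ∀ {n : ℕ}, (∀ i < n, ω i = ω' i) →
    ageAfter b τ ω n = ageAfter b τ ω' n
  | 0, _ => rfl
  | n + 1, h => by
    have ih : ageAfter b τ ω n = ageAfter b τ ω' n := ageAfter_congr fun i hi => h i (by omega)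
    simp only [ageAfter, ih, h n (by omega)]

theorem measurable_elapsed (n : ℕ) : Measurable fun ω : ℕ → ℝ × ℝ => elapsed ω n := by
  unfold elapsed
  fun_prop

theorem measurable_ageAfter (hb : Measurable b) (τ : ℝ) :
    ∀ n, Measurable fun ω : ℕ → ℝ × ℝ => ageAfter b τ ω n
  | 0 => measurable_const
  | n + 1 => by
    have ih := measurable_ageAfter hb τ n
    simp only [ageAfter]
    refine Measurable.ite (measurableSet_lt (by fun_prop) (by fun_prop)) (by fun_prop)
      (by fun_prop)

theorem measurable_ageAt (hb : Measurable b) (τ : ℝ) (n : ℕ) :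
    Measurable fun ω : ℕ → ℝ × ℝ => ageAt b τ ω n := by
  have := measurable_ageAfter hb τ n
  unfold ageAt
  fun_prop

theorem measurable_gain {k : ℝ → ℝ} (hk : Measurable k) (hb : Measurable b) (γ τ : ℝ) (n : ℕ) :
    Measurable fun ω : ℕ → ℝ × ℝ => gain γ k b τ ω n := by
  have h1 := measurable_ageAt hb τ n
  have h2 := measurable_elapsed (n + 1)
  unfold gain
  simp only [auctionTime_eq_elapsed]
  exact Measurable.ite (measurableSet_lt (by fun_prop) (by fun_prop)) (by fun_prop)
    measurable_const

variable {μ : ℝ} {P : Measure ℝ} [IsProbabilityMeasure P]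

theorem isProbabilityMeasure_outcomeLaw (hμ : 0 < μ) (P : Measure ℝ) [IsProbabilityMeasure P] :
    IsProbabilityMeasure (outcomeLaw μ P) := by
  have := isProbabilityMeasure_expMeasure hμ
  unfold outcomeLaw
  infer_instance

theorem ae_outcomeLaw_nonneg (hμ : 0 < μ) (hP : P (Iio 0) = 0) :
    ∀ᵐ ω ∂outcomeLaw μ P, ∀ i, 0 ≤ (ω i).1 ∧ 0 ≤ (ω i).2 := by
  have := isProbabilityMeasure_expMeasure hμ
  rw [ae_all_iff]
  intro i
  have h1 := measurePreserving_eval_infinitePi (fun _ : ℕ => (expMeasure μ).prod P) i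
  have h2 : ∀ᵐ p ∂(expMeasure μ).prod P, 0 ≤ p.1 ∧ 0 ≤ p.2 := by
    filter_upwards [Measure.quasiMeasurePreserving_fst.ae (ae_nonneg_expMeasure μ),
      Measure.quasiMeasurePreserving_snd.ae (ae_nonneg_of_measure_Iio_eq_zero hP)] with p h1 h2
    exact ⟨h1, h2⟩
  exact h1.quasiMeasurePreserving.ae h2

/-- The state after the first `n` auctions is independent of the outcome of the next one. -/
theorem map_state_outcome (hμ : 0 < μ) (hb : Measurable b) (τ : ℝ) (n : ℕ) :
    (outcomeLaw μ P).map (fun ω => ((elapsed ω n, ageAfter b τ ω n), ω n))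
      = ((outcomeLaw μ P).map fun ω => (elapsed ω n, ageAfter b τ ω n)).prod
        ((expMeasure μ).prod P) := by
  have := isProbabilityMeasure_expMeasure hμ
  have := isProbabilityMeasure_outcomeLaw hμ P
  have hind : iIndepFun (fun (i : ℕ) (ω : ℕ → ℝ × ℝ) => ω i) (outcomeLaw μ P) :=
    iIndepFun_infinitePi (P := fun _ : ℕ => (expMeasure μ).prod P) (X := fun _ p => p)
      fun _ => measurable_id
  have h1 := hind.indepFun_finset (Finset.range n) {n} (by simp) fun i => measurable_pi_apply i
  -- Padding the first `n` outcomes by `0` lets the state, written as a function of whole sequences,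
  -- factor through those coordinates; independence from outcome `n` follows.
  let ext : (Finset.range n → ℝ × ℝ) → ℕ → ℝ × ℝ := fun x i =>
    if h : i ∈ Finset.range n then x ⟨i, h⟩ else 0
  have hext : Measurable ext := measurable_pi_iff.2 fun i => by
    by_cases h : i ∈ Finset.range n
    · simp only [ext, dif_pos h]; fun_prop
    · simp only [ext, dif_neg h]; fun_prop
  have hstate : Measurable fun ω : ℕ → ℝ × ℝ => (elapsed ω n, ageAfter b τ ω n) :=
    (measurable_elapsed n).prodMk (measurable_ageAfter hb τ n)
  have h2 := h1.comp (hstate.comp hext)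
    (measurable_pi_apply (⟨n, Finset.mem_singleton_self n⟩ : ({n} : Finset ℕ)))
  have e : ((fun ω : ℕ → ℝ × ℝ => (elapsed ω n, ageAfter b τ ω n)) ∘ ext) ∘
      (fun (ω : ℕ → ℝ × ℝ) (i : Finset.range n) => ω i)
      = fun ω => (elapsed ω n, ageAfter b τ ω n) := by
    funext ω
    have h3 : ∀ i < n, ext (fun i : Finset.range n => ω i) i = ω i := fun i hi => by
      simp [ext, hi]
    refine Prod.ext ?_ (ageAfter_congr h3)
    exact Finset.sum_congr rfl fun i hi => congrArg Prod.fst (h3 i (Finset.mem_range.1 hi))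
  rw [e] at h2
  have h4 := (indepFun_iff_map_prod_eq_prod_map_map hstate.aemeasurable
    (measurable_pi_apply n).aemeasurable).1 h2
  have h5 := (measurePreserving_eval_infinitePi (fun _ : ℕ => (expMeasure μ).prod P) n).map_eq
  refine h4.trans ?_
  congr 1

theorem ae_elapsed_nonneg (hμ : 0 < μ) (hP : P (Iio 0) = 0) :
    ∀ᵐ ω ∂outcomeLaw μ P, ∀ n, 0 ≤ elapsed ω n := by
  filter_upwards [ae_outcomeLaw_nonneg hμ hP] with ω h n
  exact Finset.sum_nonneg fun i _ => (h i).1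

variable {γ : ℝ}

theorem integrable_exp_elapsed (hγ : 0 < γ) (hμ : 0 < μ) (hP : P (Iio 0) = 0) (n : ℕ) :
    Integrable (fun ω => Real.exp (-γ * elapsed ω n)) (outcomeLaw μ P) := by
  have := isProbabilityMeasure_outcomeLaw hμ P
  have := measurable_elapsed n
  refine Integrable.of_bound (by fun_prop) 1 ?_
  filter_upwards [ae_elapsed_nonneg hμ hP] with ω h
  rw [Real.norm_eq_abs, Real.abs_exp, Real.exp_le_one_iff]
  nlinarith [h n]

theorem integral_exp_elapsed (hγ : 0 < γ) (hμ : 0 < μ) :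
    ∀ n, ∫ ω, Real.exp (-γ * elapsed ω n) ∂outcomeLaw μ P = (μ / (γ + μ)) ^ n
  | 0 => by
    have := isProbabilityMeasure_outcomeLaw hμ P
    simp [elapsed]
  | n + 1 => by
    have := isProbabilityMeasure_outcomeLaw hμ P
    have := isProbabilityMeasure_expMeasure hμ
    -- The zero bid and zero age are dummies: only the elapsed time enters the integrand.
    have hstate : Measurable fun ω : ℕ → ℝ × ℝ => (elapsed ω n, ageAfter (fun _ => 0) 0 ω n) :=
      (measurable_elapsed n).prodMk (measurable_ageAfter measurable_const 0 n)
    have hm : Measurable fun x : (ℝ × ℝ) × (ℝ × ℝ) =>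
      Real.exp (-γ * x.1.1) * Real.exp (-γ * x.2.1) := by fun_prop
    have h1 : ∫ ω, Real.exp (-γ * elapsed ω (n + 1)) ∂outcomeLaw μ P
        = ∫ x, Real.exp (-γ * x.1.1) * Real.exp (-γ * x.2.1) ∂((outcomeLaw μ P).map
          fun ω => ((elapsed ω n, ageAfter (fun _ => 0) 0 ω n), ω n)) := by
      rw [integral_map (hstate.prodMk (measurable_pi_apply n)).aemeasurable
        hm.aestronglyMeasurable]
      congr 1
      funext ω
      rw [← Real.exp_add, elapsed_succ]
      ring_nf
    rw [h1, map_state_outcome hμ measurable_const,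
      integral_prod_mul (fun p : ℝ × ℝ => Real.exp (-γ * p.1)) fun p : ℝ × ℝ => Real.exp (-γ * p.1),
      integral_map hstate.aemeasurable (by fun_prop), integral_exp_elapsed hγ hμ n,
      integral_fun_fst (fun t : ℝ => Real.exp (-γ * t)), integral_exp_neg_expMeasure hγ hμ]
    simp [pow_succ]

end AgeProcess

/-! ### Verification -/

section Verification

/-- For a series of integrable real random variables with finite total positive and negative parts,
the difference of the two is the limit of the expected partial sums. -/
theorem tendsto_sum_integral {Ω : Type*} [MeasurableSpace Ω] {Q : Measure Ω} {f : ℕ → Ω → ℝ}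
    (hf : ∀ i, Measurable (f i)) (h1 : ∫⁻ ω, ∑' i, ENNReal.ofReal (f i ω) ∂Q ≠ ∞)
    (h2 : ∫⁻ ω, ∑' i, ENNReal.ofReal (-f i ω) ∂Q ≠ ∞) :
    (∀ i, Integrable (f i) Q) ∧
      Tendsto (fun n => ∑ i ∈ Finset.range n, ∫ ω, f i ω ∂Q) atTop
        (𝓝 ((∫⁻ ω, ∑' i, ENNReal.ofReal (f i ω) ∂Q).toReal -
          (∫⁻ ω, ∑' i, ENNReal.ofReal (-f i ω) ∂Q).toReal)) := by
  rw [lintegral_tsum fun i => (hf i).ennreal_ofReal.aemeasurable] at h1 ⊢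
  have hn : ∀ i, AEMeasurable (fun ω => ENNReal.ofReal (-f i ω)) Q := fun i =>
    (hf i).neg.ennreal_ofReal.aemeasurable
  rw [lintegral_tsum hn] at h2 ⊢
  have hi : ∀ i, Integrable (f i) Q := fun i => by
    refine ⟨(hf i).aestronglyMeasurable, ?_⟩
    have e : ∀ ω, ‖f i ω‖ₑ = ENNReal.ofReal (f i ω) + ENNReal.ofReal (-f i ω) := fun ω => by
      rw [Real.enorm_eq_ofReal_abs]
      rcases le_total 0 (f i ω) with h | h
      · rw [abs_of_nonneg h, ENNReal.ofReal_of_nonpos (neg_nonpos.2 h), add_zero]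
      · rw [abs_of_nonpos h, ENNReal.ofReal_of_nonpos h, zero_add]
    rw [HasFiniteIntegral]
    simp_rw [e]
    rw [lintegral_add_left (hf i).ennreal_ofReal]
    exact ENNReal.add_lt_top.2 ⟨(ENNReal.ne_top_of_tsum_ne_top h1 i).lt_top,
      (ENNReal.ne_top_of_tsum_ne_top h2 i).lt_top⟩
  refine ⟨hi, ?_⟩
  have h3 := (ENNReal.hasSum_toReal h1).sub (ENNReal.hasSum_toReal h2)
  rw [← ENNReal.tsum_toReal_eq (ENNReal.ne_top_of_tsum_ne_top h1),
    ← ENNReal.tsum_toReal_eq (ENNReal.ne_top_of_tsum_ne_top h2)] at h3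
  simp_rw [← fun i => integral_eq_lintegral_pos_part_sub_lintegral_neg_part (hi i)] at h3
  exact h3.tendsto_sum_nat

variable {γ μ : ℝ} {k b : ℝ → ℝ} {K τ : ℝ} {P : Measure ℝ} [IsProbabilityMeasure P]
  {W : ℝ → ℝ} {B : ℝ}

/-- Random variables dominated by a multiple of the discount factors have summable positive
parts. -/
theorem lintegral_tsum_ofReal_ne_top (hγ : 0 < γ) (hμ : 0 < μ) (hP : P (Iio 0) = 0)
    {f : ℕ → (ℕ → ℝ × ℝ) → ℝ} (hf : ∀ i, Measurable (f i)) {C : ℝ} (hC : 0 ≤ C)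
    (h : ∀ᵐ ω ∂outcomeLaw μ P, ∀ i, f i ω ≤ C * Real.exp (-γ * elapsed ω (i + 1))) :
    ∫⁻ ω, ∑' i, ENNReal.ofReal (f i ω) ∂outcomeLaw μ P ≠ ∞ := by
  have hr0 : 0 ≤ μ / (γ + μ) := by positivity
  have hr1 : μ / (γ + μ) < 1 := by rw [div_lt_one (by positivity)]; linarith
  rw [lintegral_tsum fun i => (hf i).ennreal_ofReal.aemeasurable]
  have h1 : ∀ i, ∫⁻ ω, ENNReal.ofReal (f i ω) ∂outcomeLaw μ P
      ≤ ENNReal.ofReal (C * (μ / (γ + μ)) ^ (i + 1)) := fun i => by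
    rw [← integral_exp_elapsed (P := P) hγ hμ, ← integral_const_mul,
      ofReal_integral_eq_lintegral_ofReal ((integrable_exp_elapsed hγ hμ hP _).const_mul C)
        (Eventually.of_forall fun ω => by positivity)]
    refine lintegral_mono_ae ?_
    filter_upwards [h] with ω hω
    exact ENNReal.ofReal_le_ofReal (hω i)
  refine ne_top_of_le_ne_top ?_ (ENNReal.tsum_le_tsum h1)
  have hs : Summable fun i : ℕ => C * (μ / (γ + μ)) ^ (i + 1) :=
    ((summable_nat_add_iff 1).2 (summable_geometric_of_lt_one hr0 hr1)).mul_left C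
  rw [← ENNReal.ofReal_tsum_of_nonneg (fun i => by positivity) hs]
  exact ENNReal.ofReal_ne_top

/-- Competing bids are nonnegative, so a gain never exceeds the discounted bound on `k`. Hence the
positive part of the revenue is finite under every policy. -/
theorem gain_le (hK : ∀ t, |k t| ≤ K) {ω : ℕ → ℝ × ℝ} (hω : ∀ i, 0 ≤ (ω i).1 ∧ 0 ≤ (ω i).2)
    (i : ℕ) : gain γ k b τ ω i ≤ K * Real.exp (-γ * elapsed ω (i + 1)) := by
  have hK0 := (abs_nonneg _).trans (hK 0)
  rw [gain, auctionTime_eq_elapsed]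
  split_ifs
  · rw [mul_comm]
    gcongr
    linarith [(abs_le.1 (hK (ageAt b τ ω i))).2, (hω i).2]
  · positivity

theorem integrable_discounted_continuation (hγ : 0 < γ) (hμ : 0 < μ) (hP : P (Iio 0) = 0)
    (hb : Measurable b) (hW : Continuous W) (hB : ∀ t, |W t| ≤ B) (n : ℕ) :
    Integrable (fun ω => Real.exp (-γ * elapsed ω n) * W (ageAfter b τ ω n)) (outcomeLaw μ P) := by
  refine (integrable_exp_elapsed hγ hμ hP n).mul_bdd (c := B) ?_ (Eventually.of_forall fun ω => hB _)
  exact (hW.measurable.comp (measurable_ageAfter hb τ n)).aestronglyMeasurable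

theorem abs_integral_discounted_continuation_le (hγ : 0 < γ) (hμ : 0 < μ) (hP : P (Iio 0) = 0)
    (hB : ∀ t, |W t| ≤ B) (n : ℕ) :
    |∫ ω, Real.exp (-γ * elapsed ω n) * W (ageAfter b τ ω n) ∂outcomeLaw μ P|
      ≤ B * (μ / (γ + μ)) ^ n := by
  rw [← integral_exp_elapsed (P := P) hγ hμ, ← integral_const_mul, ← Real.norm_eq_abs]
  refine norm_integral_le_of_norm_le ((integrable_exp_elapsed hγ hμ hP n).const_mul B)
    (Eventually.of_forall fun ω => ?_)
  rw [Real.norm_eq_abs, abs_mul, Real.abs_exp, mul_comm]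
  gcongr
  exact hB _

/-- The excess of the step value over the continuation value has mean zero. -/
theorem integral_discounted_excess (hγ : 0 < γ) (hμ : 0 < μ) (hP : P (Iio 0) = 0)
    (hk : Monotone k) (hK : ∀ t, |k t| ≤ K) (hW : Continuous W) (hB : ∀ t, |W t| ≤ B)
    (h : IsBellmanSolution γ μ k P W) (hb : Measurable b) (n : ℕ) :
    Integrable (fun ω => Real.exp (-γ * elapsed ω n) *
        (stepValue γ k W (ageAfter b τ ω n) (ω n) - W (ageAfter b τ ω n))) (outcomeLaw μ P) ∧
      ∫ ω, Real.exp (-γ * elapsed ω n) *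
        (stepValue γ k W (ageAfter b τ ω n) (ω n) - W (ageAfter b τ ω n)) ∂outcomeLaw μ P = 0 := by
  have := isProbabilityMeasure_outcomeLaw hμ P
  have := isProbabilityMeasure_expMeasure hμ
  have hstate : Measurable fun ω : ℕ → ℝ × ℝ => ((elapsed ω n, ageAfter b τ ω n), ω n) :=
    ((measurable_elapsed n).prodMk (measurable_ageAfter hb τ n)).prodMk (measurable_pi_apply n)
  have hsv := measurable_stepValue (γ := γ) hk hW
  let G : (ℝ × ℝ) × (ℝ × ℝ) → ℝ := fun x =>
    Real.exp (-γ * x.1.1) * (stepValue γ k W x.1.2 x.2 - W x.1.2)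
  have hG : Measurable G := by
    have h1 : Measurable fun x : (ℝ × ℝ) × (ℝ × ℝ) => stepValue γ k W x.1.2 x.2 :=
      hsv.comp (f := fun x : (ℝ × ℝ) × (ℝ × ℝ) => (x.1.2, x.2)) (by fun_prop)
    have h2 := hW.measurable
    fun_prop
  have hint : Integrable (fun ω => G ((elapsed ω n, ageAfter b τ ω n), ω n))
      (outcomeLaw μ P) := by
    refine (integrable_exp_elapsed hγ hμ hP n).mul_bdd (c := K + B + B) ?_ ?_
    · have h1 : Measurable fun ω : ℕ → ℝ × ℝ => (ageAfter b τ ω n, ω n) :=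
        (measurable_ageAfter hb τ n).prodMk (measurable_pi_apply n)
      exact ((hsv.comp h1).sub
        (hW.measurable.comp (measurable_ageAfter hb τ n))).aestronglyMeasurable
    · filter_upwards [ae_outcomeLaw_nonneg hμ hP] with ω hω
      have h1 := abs_stepValue_le hγ hK hB (ageAfter b τ ω n) (hω n).1 (hω n).2
      have h2 := hB (ageAfter b τ ω n)
      rw [Real.norm_eq_abs]
      refine (abs_sub _ _).trans ?_
      linarith
  refine ⟨hint, ?_⟩
  change ∫ ω, G ((elapsed ω n, ageAfter b τ ω n), ω n) ∂outcomeLaw μ P = 0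
  have hint' := (integrable_map_measure hG.aestronglyMeasurable hstate.aemeasurable).2 hint
  rw [← integral_map hstate.aemeasurable hG.aestronglyMeasurable]
  rw [map_state_outcome hμ hb] at hint' ⊢
  rw [integral_prod _ hint']
  -- With the state frozen, the mean of `stepValue` over the next outcome is the continuation value,
  -- by the Bellman equation.
  have h0 : ∀ x : ℝ × ℝ, ∫ y, G (x, y) ∂(expMeasure μ).prod P = 0 := fun x => by
    have hi : Integrable (stepValue γ k W x.2) ((expMeasure μ).prod P) := by
      refine Integrable.of_bound
        (hsv.comp (measurable_const.prodMk measurable_id)).aestronglyMeasurable (K + B) ?_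
      filter_upwards [Measure.quasiMeasurePreserving_fst.ae (ae_nonneg_expMeasure μ),
        Measure.quasiMeasurePreserving_snd.ae (ae_nonneg_of_measure_Iio_eq_zero hP)] with p h1 h2
      exact abs_stepValue_le hγ hK hB _ h1 h2
    simp only [G]
    rw [integral_const_mul, integral_sub hi (integrable_const _),
      integral_stepValue hP hγ hμ hk hK hW hB h]
    simp
  simp [h0]

/-- The optimal bid for the continuation value `W`. -/
def optimalBid (k W : ℝ → ℝ) (t : ℝ) : ℝ := max (k t + W 0 - W t) 0

theorem measurable_optimalBid (hk : Monotone k) (hW : Continuous W) :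
    Measurable (optimalBid k W) := by
  have h1 := hk.measurable
  have h2 := hW.measurable
  unfold optimalBid
  fun_prop

/-- Winning and losing realise the two entries of the maximum in `stepValue`; this is the pathwise
supermartingale inequality. -/
theorem gain_add_continuation_le (ω : ℕ → ℝ × ℝ) (i : ℕ) :
    gain γ k b τ ω i + Real.exp (-γ * elapsed ω (i + 1)) * W (ageAfter b τ ω (i + 1))
      ≤ Real.exp (-γ * elapsed ω i) * stepValue γ k W (ageAfter b τ ω i) (ω i) := by
  have e : Real.exp (-γ * elapsed ω (i + 1))
      = Real.exp (-γ * elapsed ω i) * Real.exp (-γ * (ω i).1) := by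
    rw [← Real.exp_add, elapsed_succ]; ring_nf
  rw [gain, auctionTime_eq_elapsed, e, ageAfter, stepValue, ageAt, ← mul_assoc]
  split_ifs with hwin
  · rw [← mul_add]
    gcongr
    refine le_trans (le_of_eq ?_) (le_max_right _ _)
    ring
  · rw [zero_add]
    gcongr
    exact le_max_left _ _

/-- This bid wins exactly when winning is strictly the better entry of the maximum. Clipping it at
`0` changes no outcome, since no nonnegative competing bid lies below `0`. -/
theorem gain_add_continuation_optimalBid {ω : ℕ → ℝ × ℝ} (i : ℕ) (hω : 0 ≤ (ω i).2) :
    gain γ k (optimalBid k W) τ ω i +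
        Real.exp (-γ * elapsed ω (i + 1)) * W (ageAfter (optimalBid k W) τ ω (i + 1))
      = Real.exp (-γ * elapsed ω i) *
        stepValue γ k W (ageAfter (optimalBid k W) τ ω i) (ω i) := by
  have e : Real.exp (-γ * elapsed ω (i + 1))
      = Real.exp (-γ * elapsed ω i) * Real.exp (-γ * (ω i).1) := by
    rw [← Real.exp_add, elapsed_succ]; ring_nf
  rw [gain, auctionTime_eq_elapsed, e, ageAfter, stepValue, ageAt, ← mul_assoc]
  set s := ageAfter (optimalBid k W) τ ω i + (ω i).1
  split_ifs with hwin
  · have : (ω i).2 < k s + W 0 - W s := (lt_max_iff.1 hwin).resolve_right (not_lt.2 hω)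
    rw [max_eq_right (by linarith)]
    ring
  · have : k s + W 0 - W s ≤ (ω i).2 := (le_max_left _ _).trans (not_lt.1 hwin)
    rw [max_eq_left (by linarith)]
    ring

/-- A win forces `C < k + W 0 - W`, so the loss `C - k` is below `W 0 - W ≤ 2 * B`. This rules out
the value `-∞` for the optimal bid. -/
theorem neg_gain_optimalBid_le (hB : ∀ t, |W t| ≤ B) {ω : ℕ → ℝ × ℝ}
    (hω : ∀ i, 0 ≤ (ω i).1 ∧ 0 ≤ (ω i).2) (i : ℕ) :
    -gain γ k (optimalBid k W) τ ω i ≤ 2 * B * Real.exp (-γ * elapsed ω (i + 1)) := by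
  have hB0 := (abs_nonneg _).trans (hB 0)
  rw [gain, auctionTime_eq_elapsed]
  set s := ageAt (optimalBid k W) τ ω i
  split_ifs with hwin
  · have : (ω i).2 < k s + W 0 - W s := (lt_max_iff.1 hwin).resolve_right (not_lt.2 (hω i).2)
    rw [← mul_neg, mul_comm]
    gcongr
    linarith [(abs_le.1 (hB s)).1, (abs_le.1 (hB 0)).2]
  · rw [neg_zero]; positivity

theorem tendsto_continuation (hγ : 0 < γ) (hμ : 0 < μ) (hP : P (Iio 0) = 0)
    (hB : ∀ t, |W t| ≤ B) :
    Tendsto (fun n => ∫ ω, Real.exp (-γ * elapsed ω n) * W (ageAfter b τ ω n) ∂outcomeLaw μ P)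
      atTop (𝓝 0) := by
  have hr0 : 0 ≤ μ / (γ + μ) := by positivity
  have hr1 : μ / (γ + μ) < 1 := by rw [div_lt_one (by positivity)]; linarith
  refine squeeze_zero_norm (abs_integral_discounted_continuation_le hγ hμ hP hB) ?_
  simpa using (tendsto_pow_atTop_nhds_zero_of_lt_one hr0 hr1).const_mul B

theorem integral_zero_continuation (hμ : 0 < μ) :
    ∫ ω, Real.exp (-γ * elapsed ω 0) * W (ageAfter b τ ω 0) ∂outcomeLaw μ P = W τ := by
  have := isProbabilityMeasure_outcomeLaw hμ P
  simp [elapsed, ageAfter]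

/-- No policy does better than a solution of the Bellman equation. -/
theorem policyValue_le (hγ : 0 < γ) (hμ : 0 < μ) (hP : P (Iio 0) = 0)
    (hk : Monotone k) (hK : ∀ t, |k t| ≤ K) (hW : Continuous W) (hB : ∀ t, |W t| ≤ B)
    (h : IsBellmanSolution γ μ k P W) (hb : Measurable b) :
    policyValue γ μ k P b τ ≤ (W τ : EReal) := by
  have hg := measurable_gain hk.measurable hb γ τ
  have hpos : ∫⁻ ω, ∑' i, ENNReal.ofReal (gain γ k b τ ω i) ∂outcomeLaw μ P ≠ ∞ :=
    lintegral_tsum_ofReal_ne_top hγ hμ hP hg ((abs_nonneg _).trans (hK 0)) (by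
      filter_upwards [ae_outcomeLaw_nonneg hμ hP] with ω hω i
      exact gain_le hK hω i)
  unfold policyValue
  -- An infinite negative part makes the value `-∞`, and the bound is trivial.
  by_cases hneg : ∫⁻ ω, ∑' i, ENNReal.ofReal (-gain γ k b τ ω i) ∂outcomeLaw μ P = ∞
  · rw [hneg]; simp
  obtain ⟨hi, hlim⟩ := tendsto_sum_integral hg hpos hneg
  rw [← EReal.coe_ennreal_toReal hpos, ← EReal.coe_ennreal_toReal hneg, ← EReal.coe_sub,
    EReal.coe_le_coe_iff]
  set m : ℕ → ℝ := fun n =>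
    ∫ ω, Real.exp (-γ * elapsed ω n) * W (ageAfter b τ ω n) ∂outcomeLaw μ P with hm
  have hc := fun n => integrable_discounted_continuation (τ := τ) hγ hμ hP hb hW hB n
  -- The expected gain of auction `i` is at most the drop of the expected discounted continuation
  -- value `m`; the sum telescopes to `W τ - m n`, and `m n → 0`.
  have hstep : ∀ i, ∫ ω, gain γ k b τ ω i ∂outcomeLaw μ P ≤ m i - m (i + 1) := fun i => by
    obtain ⟨he, he0⟩ := integral_discounted_excess (τ := τ) hγ hμ hP hk hK hW hB h hb i
    have h1 := integral_mono ((hi i).add (hc (i + 1))) (he.add (hc i)) fun ω => by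
      have := gain_add_continuation_le (γ := γ) (k := k) (b := b) (τ := τ) (W := W) ω i
      simp only [Pi.add_apply]
      linarith
    rw [integral_add' (hi i) (hc (i + 1)), integral_add' he (hc i), he0] at h1
    simp only [hm]
    linarith
  have hm0 : m 0 = W τ := integral_zero_continuation hμ
  have hlim' : Tendsto (fun n => W τ - m n) atTop (𝓝 (W τ - 0)) :=
    (tendsto_continuation hγ hμ hP hB).const_sub _
  rw [sub_zero] at hlim'
  refine le_of_tendsto_of_tendsto' hlim hlim' fun n => ?_
  calc _ ≤ ∑ i ∈ Finset.range n, (m i - m (i + 1)) := Finset.sum_le_sum fun i _ => hstep i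
    _ = W τ - m n := by rw [Finset.sum_range_sub', hm0]

/-- The optimal bid attains the solution of the Bellman equation. -/
theorem policyValue_optimalBid (hγ : 0 < γ) (hμ : 0 < μ) (hP : P (Iio 0) = 0)
    (hk : Monotone k) (hK : ∀ t, |k t| ≤ K) (hW : Continuous W) (hB : ∀ t, |W t| ≤ B)
    (h : IsBellmanSolution γ μ k P W) :
    policyValue γ μ k P (optimalBid k W) τ = (W τ : EReal) := by
  have hb := measurable_optimalBid hk hW
  have hg := measurable_gain hk.measurable hb γ τ
  have hpos : ∫⁻ ω, ∑' i, ENNReal.ofReal (gain γ k (optimalBid k W) τ ω i) ∂outcomeLaw μ P ≠ ∞ :=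
    lintegral_tsum_ofReal_ne_top hγ hμ hP hg ((abs_nonneg _).trans (hK 0)) (by
      filter_upwards [ae_outcomeLaw_nonneg hμ hP] with ω hω i
      exact gain_le hK hω i)
  have hB0 := (abs_nonneg _).trans (hB 0)
  have hneg : ∫⁻ ω, ∑' i, ENNReal.ofReal (-gain γ k (optimalBid k W) τ ω i) ∂outcomeLaw μ P ≠ ∞ :=
    lintegral_tsum_ofReal_ne_top hγ hμ hP (fun i => (hg i).neg) (C := 2 * B) (by positivity) (by
      filter_upwards [ae_outcomeLaw_nonneg hμ hP] with ω hω i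
      exact neg_gain_optimalBid_le hB hω i)
  obtain ⟨hi, hlim⟩ := tendsto_sum_integral hg hpos hneg
  rw [policyValue, ← EReal.coe_ennreal_toReal hpos, ← EReal.coe_ennreal_toReal hneg,
    ← EReal.coe_sub, EReal.coe_eq_coe_iff]
  set m : ℕ → ℝ := fun n =>
    ∫ ω, Real.exp (-γ * elapsed ω n) * W (ageAfter (optimalBid k W) τ ω n) ∂outcomeLaw μ P with hm
  have hc := fun n => integrable_discounted_continuation (τ := τ) hγ hμ hP hb hW hB n
  have hstep : ∀ i, ∫ ω, gain γ k (optimalBid k W) τ ω i ∂outcomeLaw μ P = m i - m (i + 1) :=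
    fun i => by
    obtain ⟨he, he0⟩ := integral_discounted_excess (τ := τ) hγ hμ hP hk hK hW hB h hb i
    have h1 := integral_congr_ae (μ := outcomeLaw μ P)
      (f := (fun ω => gain γ k (optimalBid k W) τ ω i) + _) (g := _ + _) (by
        filter_upwards [ae_outcomeLaw_nonneg hμ hP] with ω hω
        have := gain_add_continuation_optimalBid (γ := γ) (k := k) (τ := τ) (W := W) i (hω i).2
        exact this.trans (by ring : _ = (fun ω => Real.exp (-γ * elapsed ω i) *
          (stepValue γ k W (ageAfter (optimalBid k W) τ ω i) (ω i)
            - W (ageAfter (optimalBid k W) τ ω i))) ω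
          + (fun ω => Real.exp (-γ * elapsed ω i) * W (ageAfter (optimalBid k W) τ ω i)) ω))
    rw [integral_add' (hi i) (hc (i + 1)), integral_add' he (hc i), he0] at h1
    simp only [hm]
    linarith
  have hm0 : m 0 = W τ := integral_zero_continuation hμ
  have hlim' : Tendsto (fun n => W τ - m n) atTop (𝓝 (W τ - 0)) :=
    (tendsto_continuation hγ hμ hP hB).const_sub _
  rw [sub_zero] at hlim'
  refine tendsto_nhds_unique hlim (hlim'.congr fun n => ?_)
  rw [Finset.sum_congr rfl fun i _ => hstep i, Finset.sum_range_sub', hm0]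

theorem optimalValue_eq (hγ : 0 < γ) (hμ : 0 < μ) (hP : P (Iio 0) = 0)
    (hk : Monotone k) (hK : ∀ t, |k t| ≤ K) (hW : Continuous W) (hB : ∀ t, |W t| ≤ B)
    (h : IsBellmanSolution γ μ k P W) (τ : ℝ) : optimalValue γ μ k P τ = (W τ : EReal) := by
  refine le_antisymm (iSup₂_le fun b hb => policyValue_le hγ hμ hP hk hK hW hB h hb.1) ?_
  rw [← policyValue_optimalBid hγ hμ hP hk hK hW hB h]
  exact le_iSup₂ (f := fun b (_ : b ∈ biddingFunctions) => policyValue γ μ k P b τ) _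
    ⟨measurable_optimalBid hk hW, fun t => le_max_right _ _⟩

end Verification

/-! ### Only the values of `k` at nonnegative ages matter -/

section Extension

variable {γ μ : ℝ} {k k' : ℝ → ℝ} {P : Measure ℝ} [IsProbabilityMeasure P]

theorem ageAfter_nonneg {b : ℝ → ℝ} {τ : ℝ} (hτ : 0 ≤ τ) {ω : ℕ → ℝ × ℝ}
    (hω : ∀ i, 0 ≤ (ω i).1) : ∀ n, 0 ≤ ageAfter b τ ω n
  | 0 => hτ
  | n + 1 => by
    have ih := ageAfter_nonneg (b := b) hτ hω n
    have := hω n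
    rw [ageAfter]
    split_ifs <;> linarith

theorem optimalValue_congr (hμ : 0 < μ) (hP : P (Iio 0) = 0) (h : EqOn k k' (Ici 0)) {τ : ℝ}
    (hτ : 0 ≤ τ) : optimalValue γ μ k P τ = optimalValue γ μ k' P τ := by
  have hg : ∀ b, ∀ᵐ ω ∂outcomeLaw μ P, ∀ i, gain γ k b τ ω i = gain γ k' b τ ω i := fun b => by
    filter_upwards [ae_outcomeLaw_nonneg hμ hP] with ω hω i
    have h0 : 0 ≤ ageAt b τ ω i := add_nonneg (ageAfter_nonneg hτ (fun i => (hω i).1) i) (hω i).1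
    rw [gain, gain, h h0]
  unfold optimalValue
  refine iSup_congr fun b => iSup_congr fun _ => ?_
  unfold policyValue
  congr 1
  · refine congrArg _ (lintegral_congr_ae ?_)
    filter_upwards [hg b] with ω hω
    simp_rw [hω]
  · refine congrArg _ (lintegral_congr_ae ?_)
    filter_upwards [hg b] with ω hω
    simp_rw [hω]

/-- An equality of predicates, not a mere equivalence, allows rewriting inside `solution`, which is
defined by choice. -/
theorem isCauchySolution_congr (h : EqOn k k' (Ici 0)) (q : ℝ → ℝ) :
    IsCauchySolution γ μ k q = IsCauchySolution γ μ k' q := by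
  funext v Y
  unfold IsCauchySolution
  refine propext (and_congr_right fun _ => forall₂_congr fun t ht => ?_)
  rw [intervalIntegral.integral_congr (g := fun s => drift γ μ k' q s (Y s) v)]
  intro s hs
  rw [uIcc_of_le ht] at hs
  simp only [drift, h hs.1]

theorem solution_congr (h : EqOn k k' (Ici 0)) (q : ℝ → ℝ) :
    solution γ μ k q = solution γ μ k' q := by
  unfold solution
  rw [isCauchySolution_congr h q]

end Extension

/-! ### The bisection -/

section Bisection

variable {γ μ : ℝ} {k q : ℝ → ℝ}

theorem bracket_length (a b : ℝ) (n : ℕ) :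
    (bracket γ μ k q a b n).2 - (bracket γ μ k q a b n).1 = (b - a) / 2 ^ n := by
  induction n with
  | zero => simp [bracket]
  | succ n ih =>
    rw [pow_succ, ← div_div, ← ih, bracket]
    split_ifs <;> ring

/-- The brackets keep a point that separates divergence to `+∞` from the other behaviours. -/
theorem mem_bracket {V : ℝ} (h1 : ∀ c, V < c → Tendsto (solution γ μ k q c) atTop atTop)
    (h2 : ∀ c, c < V → ¬ Tendsto (solution γ μ k q c) atTop atTop) {a b : ℝ} (ha : a ≤ V)
    (hb : V ≤ b) (n : ℕ) : (bracket γ μ k q a b n).1 ≤ V ∧ V ≤ (bracket γ μ k q a b n).2 := by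
  induction n with
  | zero => exact ⟨ha, hb⟩
  | succ n ih =>
    rw [bracket]
    -- Nothing is assumed at `c = V`: either answer of the test then keeps `V` as an endpoint.
    split_ifs with hT
    · exact ⟨ih.1, not_lt.1 fun hlt => h2 _ hlt hT⟩
    · exact ⟨not_lt.1 fun hlt => hT (h1 _ hlt), ih.2⟩

end Bisection

end RepeatedAuction

theorem mainTheorem1 (γ μ : ℝ) (hγ : 0 < γ) (hμ : 0 < μ)
    (k : ℝ → ℝ) (hk : MonotoneOn k (Ici 0)) (hkb : ∃ K : ℝ, ∀ t, 0 ≤ t → |k t| ≤ K)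
    (P : Measure ℝ) [IsProbabilityMeasure P] (hP : P (Iio 0) = 0)
    (hq : Continuous (cdf P)) :
    (∀ v : ℝ,
      RepeatedAuction.IsCauchySolution γ μ k (cdf P) v
          (RepeatedAuction.solution γ μ k (cdf P) v) ∧
        ∀ Y : ℝ → ℝ, RepeatedAuction.IsCauchySolution γ μ k (cdf P) v Y →
          EqOn Y (RepeatedAuction.solution γ μ k (cdf P) v) (Ici 0)) ∧
      ∃ V : ℝ, RepeatedAuction.optimalValue γ μ k P 0 = (V : EReal) ∧
        ∀ a b : ℝ, a ≤ V → V ≤ b →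
          (fun n : ℕ => V - RepeatedAuction.iterate γ μ k (cdf P) a b n 0) =O[atTop]
            (fun n : ℕ => (1 : ℝ) / 2 ^ n) := by
  open RepeatedAuction in
  obtain ⟨K, hK⟩ := hkb
  -- extend `k` to a monotone bounded function on the whole line
  set k' : ℝ → ℝ := fun t => k (max t 0) with hk'
  have hkk : EqOn k k' (Ici 0) := fun t ht => by simp only [hk', max_eq_left (mem_Ici.1 ht)]
  have hmono : Monotone k' := fun s t hst =>
    hk (mem_Ici.2 (le_max_right _ _)) (mem_Ici.2 (le_max_right _ _)) (max_le_max_right 0 hst)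
  have hbdd : ∀ t, |k' t| ≤ K := fun t => hK _ (le_max_right _ _)
  have hsol : ∀ v, IsCauchySolution γ μ k (cdf P) v (solution γ μ k (cdf P) v) := fun v => by
    rw [solution_congr hkk, isCauchySolution_congr hkk]
    exact isCauchySolution_solution P hγ hμ hmono hbdd v
  have hsol' := hsol
  rw [isCauchySolution_congr hkk] at hsol'
  refine ⟨fun v => ⟨hsol v, fun Y hY => ?_⟩, ?_⟩
  · rw [isCauchySolution_congr hkk] at hY
    exact hY.eqOn hγ hμ hmono hbdd (hsol' v)
  obtain ⟨W, B, hW, hB, hbell⟩ := exists_isBellmanSolution hγ hμ hmono hbdd P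
  have hWsol := hbell.isCauchySolution hγ hμ hmono hbdd hW hB
  refine ⟨W 0, ?_, fun a b ha hb => ?_⟩
  · rw [optimalValue_congr hμ hP hkk le_rfl]
    exact optimalValue_eq hγ hμ hP hmono hbdd hW hB hbell 0
  -- The iterate at time `0` is the midpoint of the bracket. Both it and `W 0` lie in the bracket,
  -- whose length is `(b - a) / 2 ^ n`.
  refine IsBigO.of_bound (b - a) (Eventually.of_forall fun n => ?_)
  obtain ⟨h1, h2⟩ := mem_bracket (q := cdf P) (k := k)
    (fun c hc => hWsol.tendsto_atTop hγ hμ hmono hbdd hc (hsol' c) hB)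
    (fun c hc => hWsol.not_tendsto_atTop hγ hμ hmono hbdd hc (hsol' c) hB) ha hb n
  have hlen := bracket_length (γ := γ) (μ := μ) (k := k) (q := cdf P) a b n
  rw [RepeatedAuction.iterate, (hsol _).apply_zero, Real.norm_eq_abs,
    Real.norm_of_nonneg (by positivity), mul_one_div, ← hlen, abs_le]
  constructor <;> linarith
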